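/- Work over $\mathbb{C}$. Let $\widehat{\Sigma}^{13}$ be the closed subscheme of $\mathbb{A}(S,\boldsymbol t)\times\mathbb{P}(\boldsymbol p,p_4,\boldsymbol q,r,u)\simeq\mathbb{A}^9\times\mathbb{P}^8$, where $S=(s_{ij})$ is a symmetric $3\times 3$ matrix of coordinates, $\boldsymbol p={}^t(p_1,p_2,p_3)$, $\boldsymbol q={}^t(q_1,q_2,q_3)$ and $\boldsymbol t={}^t(t_1,t_2,t_3)$, defined by the nine equations $${}^t\boldsymbol p\,\boldsymbol q=0,\quad (rI+AS)\boldsymbol p=-p_4A\boldsymbol t,\quad {}^t\boldsymbol p S\boldsymbol p+p_4\,{}^t\boldsymbol p\,\boldsymbol t=0,\quad u\boldsymbol p=(rI-AS)A\boldsymbol t,\quad up_4=-(r^2+{}^t\boldsymbol q S^{\dagger}\boldsymbol q),$$ where $A=\begin{pmatrix}0&-q_3&q_2\\ q_3&0&-q_1\\ -q_2&q_1&0\end{pmatrix}$ and $S^{\dagger}$ is the adjugate of $S$. Let $\rho_\Sigma\colon\widehat{\Sigma}^{13}\to\mathbb{A}(S,\boldsymbol t)$ be the projection. Let $\widehat{\Upsilon}^{13}$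 be the closed subscheme of $\mathbb{A}(z,s_i,t_j)\times\mathbb{P}(x_1,x_2,y_1,y_2,p_1,p_2,p_3,p_4,u)\simeq\mathbb{A}^9\times\mathbb{P}^8$ $(1\le i,j\le 4)$ defined by the following nine equations. Let $\Delta_{ij}$ be the minor in columns $i,j$ of $\begin{pmatrix}y_1&y_2&zx_1&zx_2\\ x_1&x_2&y_1&y_2\end{pmatrix}$, and set $A_{12}=p_4t_1-p_2s_1$, $B_{11}=p_2s_2-p_4t_2$, $B_{12}=\tfrac12(p_2s_3-p_4t_3)$, $B_{22}=p_2s_4-p_4t_4$. The equations are * $up_2=t_1\Delta_{12}+t_2\Delta_{13}+t_3\Delta_{23}+t_4\Delta_{24}$ and $up_4=s_1\Delta_{12}+s_2\Delta_{13}+s_3\Delta_{23}+s_4\Delta_{24}$; * the vanishing of the five $4\times4$ Pfaffians of the $5\times 5$ skew-symmetric matrix with upper triangular part $\begin{pmatrix}0&x_1&x_2&y_1&y_2\\ &0&-p_1&-B_{22}&p_3+B_{12}\\ &&0&-p_3+B_{12}&-B_{11}\\ &&&0&-zp_1-A_{12}\\ &&&&0\end{pmatrix}$; * $p_1u+(t_1\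 t_2\ t_3\ t_4)M_1\,{}^t(s_1\ s_2\ s_3\ s_4)=0$ and $p_3u+(t_1\ t_2\ t_3\ t_4)M_3\,{}^t(s_1\ s_2\ s_3\ s_4)=0$, where $M_1$ and $M_3$ are the skew-symmetric matrices with upper triangular parts $$\begin{pmatrix}0&-x_1^2&-x_1x_2&-x_2^2\\ &0&-x_1y_1&-x_1y_2-x_2y_1\\ &&0&-x_2y_2\\ &&&0\end{pmatrix},\quad \begin{pmatrix}0&x_1y_1&\tfrac12(x_1y_2+x_2y_1)&x_2y_2\\ &0&\tfrac12(y_1^2+zx_1^2)&y_1y_2+zx_1x_2\\ &&0&\tfrac12(y_2^2+zx_2^2)\\ &&&0\end{pmatrix}.$$ Let $\rho_\Upsilon\colon\widehat{\Upsilon}^{13}\to\mathbb{A}(z,s_i,t_j)$ be the projection. Proposition. There is no pair of isomorphisms of $\mathbb{C}$-schemes $\varphi\colon\widehat{\Sigma}^{13}\to\widehat{\Upsilon}^{13}$ and $\psi\colon\mathbb{A}(S,\boldsymbol t)\to\mathbb{A}(z,s_i,t_j)$ with $\rho_\Upsilon\circ\varphi=\psi\circ\rho_\Sigma$. Moreover,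 the (scheme-theoretic) fibre of $\rho_\Upsilon$ over the origin is not isomorphic, as a $\mathbb{C}$-scheme, to the fibre of $\rho_\Sigma$ over any point of $\mathbb{A}(S,\boldsymbol t)(\mathbb{C})=\mathbb{C}^9$. -/

import Mathlib

open CategoryTheory AlgebraicGeometry

namespace QuadricFamily

attribute [local instance] MvPolynomial.gradedAlgebra

section Grading

variable {R P : Type*} [CommRing R] [CommRing P] [Algebra R P]
  (G : ℕ → Submodule R P) [GradedAlgebra G] (I : HomogeneousIdeal G)

/-- The grading of `P ⧸ I` by the images of the graded pieces of `P`. -/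
def quotientGrading (n : ℕ) : Submodule R (P ⧸ I.toIdeal) :=
  (G n).map (Ideal.Quotient.mkₐ R I.toIdeal).toLinearMap

instance quotientGrading.gradedMonoid : SetLike.GradedMonoid (quotientGrading G I) where
  one_mem := ⟨1, SetLike.GradedOne.one_mem, map_one (Ideal.Quotient.mkₐ R I.toIdeal)⟩
  mul_mem := by
    rintro i j _ _ ⟨a, ha, rfl⟩ ⟨b, hb, rfl⟩
    exact ⟨a * b, SetLike.GradedMul.mul_mem ha hb, map_mul (Ideal.Quotient.mkₐ R I.toIdeal) a b⟩

/-- The quotient map in degree `n`. -/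
def quotientGradingMk (n : ℕ) : G n →ₗ[R] quotientGrading G I n :=
  (Ideal.Quotient.mkₐ R I.toIdeal).toLinearMap.submoduleMap (G n)

/-- Decomposition of the image in `P ⧸ I` of an element of `P`. -/
noncomputable def quotientDecomposeAux : P →ₗ[R] DirectSum ℕ fun n => quotientGrading G I n :=
  (DirectSum.lmap (quotientGradingMk G I)).comp (DirectSum.decomposeLinearEquiv G).toLinearMap

theorem quotientDecomposeAux_eq_zero (x : P) (hx : x ∈ I.toIdeal) :
    quotientDecomposeAux G I x = 0 := by
  refine DFinsupp.ext fun n => Subtype.ext ?_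
  have : (Ideal.Quotient.mk I.toIdeal) (DirectSum.decompose G x n : P) = 0 :=
    Ideal.Quotient.eq_zero_iff_mem.2 (I.isHomogeneous n hx)
  exact this

theorem quotientDecomposeAux_of_mem (n : ℕ) (x : P) (hx : x ∈ G n) :
    quotientDecomposeAux G I x =
      DirectSum.lof R ℕ (fun n => quotientGrading G I n) n (quotientGradingMk G I n ⟨x, hx⟩) := by
  change DirectSum.lmap (quotientGradingMk G I) (DirectSum.decompose G x) = _
  rw [DirectSum.decompose_of_mem G hx, ← DirectSum.lof_eq_of R, DirectSum.lmap_lof]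

/-- Decomposition of an element of `P ⧸ I` into homogeneous components. -/
noncomputable def quotientDecompose :
    (P ⧸ I.toIdeal) →+ DirectSum ℕ fun n => quotientGrading G I n :=
  QuotientAddGroup.lift I.toIdeal.toAddSubgroup (quotientDecomposeAux G I).toAddMonoidHom
    (quotientDecomposeAux_eq_zero G I)

theorem quotientDecompose_mk (x : P) :
    quotientDecompose G I (Ideal.Quotient.mk I.toIdeal x) = quotientDecomposeAux G I x := rfl

noncomputable instance quotientGrading.gradedAlgebra : GradedAlgebra (quotientGrading G I) where
  toGradedMonoid := quotientGrading.gradedMonoid G I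
  toDecomposition := DirectSum.Decomposition.ofAddHom (quotientGrading G I)
    (quotientDecompose G I)
    (by
      refine AddMonoidHom.ext fun y => ?_
      obtain ⟨x, rfl⟩ := Ideal.Quotient.mk_surjective y
      rw [AddMonoidHom.comp_apply, quotientDecompose_mk, AddMonoidHom.id_apply]
      induction x using DirectSum.Decomposition.inductionOn G with
      | zero => simp
      | @homogeneous n x =>
        rw [quotientDecomposeAux_of_mem G I n x x.2, DirectSum.lof_eq_of, DirectSum.coeAddMonoidHom_of]
        rfl
      | add x y hx hy => rw [map_add, map_add, map_add, hx, hy])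
    (by
      refine DirectSum.addHom_ext' fun n => AddMonoidHom.ext ?_
      rintro ⟨_, x, hx, rfl⟩
      rw [AddMonoidHom.comp_apply, AddMonoidHom.comp_apply, DirectSum.coeAddMonoidHom_of]
      exact quotientDecomposeAux_of_mem G I n x hx)

end Grading

section Family

/-- The affine space over `ℂ` with coordinates indexed by `B`, as a scheme over `Spec ℂ`. -/
noncomputable def affineSpace (B : Type) : Over (Spec (CommRingCat.of ℂ)) :=
  Over.mk (Spec.map (CommRingCat.ofHom (algebraMap ℂ (MvPolynomial B ℂ))))

/-- The closed point of the affine space with coordinates `a`. -/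
noncomputable def affinePoint {B : Type} (a : B → ℂ) : (affineSpace B).left :=
  (⟨RingHom.ker (MvPolynomial.eval a), RingHom.ker_isPrime _⟩ : PrimeSpectrum (MvPolynomial B ℂ))

/- An ideal `I` of `ℂ[B][F]`, homogeneous in the variables `F` (the variables `B` are regarded
as constants), defines a closed subscheme of `𝔸(B) × ℙ(F)`, namely `Proj (ℂ[B][F] ⧸ I)`
over `Spec ℂ[B]`. -/
variable {B F : Type}
  (I : HomogeneousIdeal (MvPolynomial.homogeneousSubmodule F (MvPolynomial B ℂ)))

/-- The projection of `Proj (ℂ[B][F] ⧸ I)` to `Spec ℂ[B]`. -/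
noncomputable def projToSpec :
    Proj (quotientGrading (MvPolynomial.homogeneousSubmodule F (MvPolynomial B ℂ)) I) ⟶
      Spec (CommRingCat.of (MvPolynomial B ℂ)) :=
  Proj.toSpecZero _ ≫ Spec.map (CommRingCat.ofHom (algebraMap (MvPolynomial B ℂ)
    (quotientGrading (MvPolynomial.homogeneousSubmodule F (MvPolynomial B ℂ)) I 0)))

/-- The closed subscheme of `𝔸(B) × ℙ(F)` defined by `I`, as a scheme over `Spec ℂ`. -/
noncomputable def family : Over (Spec (CommRingCat.of ℂ)) :=
  Over.mk (projToSpec I ≫ (affineSpace B).hom)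

/-- The natural projection of the closed subscheme of `𝔸(B) × ℙ(F)` defined by `I`
to `𝔸(B)`. -/
noncomputable def family.proj : family I ⟶ affineSpace B :=
  Over.homMk (projToSpec I) rfl

end Family

/-- The scheme-theoretic fibre of a morphism of schemes over `ℂ`, as a scheme over `ℂ`. -/
noncomputable def fibre {X Y : Over (Spec (CommRingCat.of ℂ))} (f : X ⟶ Y) (y : Y.left) :
    Over (Spec (CommRingCat.of ℂ)) :=
  Over.mk (f.left.fiberι y ≫ X.hom)

section Homogeneous

open MvPolynomial Matrix

variable {R σ : Type} [CommRing R] {m n : Type} [Fintype m] {d e : ℕ}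

theorem isHomogeneous_dotProduct {v w : m → MvPolynomial σ R} (hv : ∀ i, (v i).IsHomogeneous d)
    (hw : ∀ i, (w i).IsHomogeneous e) : (v ⬝ᵥ w).IsHomogeneous (d + e) :=
  IsHomogeneous.sum _ _ _ fun i _ => (hv i).mul (hw i)

theorem isHomogeneous_mulVec {M : Matrix n m (MvPolynomial σ R)} {w : m → MvPolynomial σ R}
    (hM : ∀ i j, (M i j).IsHomogeneous d) (hw : ∀ i, (w i).IsHomogeneous e) (i : n) :
    ((M *ᵥ w) i).IsHomogeneous (d + e) :=
  isHomogeneous_dotProduct (hM i) hw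

theorem isHomogeneous_mul {l : Type} {M : Matrix l m (MvPolynomial σ R)}
    {N : Matrix m n (MvPolynomial σ R)}
    (hM : ∀ i j, (M i j).IsHomogeneous d) (hN : ∀ i j, (N i j).IsHomogeneous e) (i : l) (j : n) :
    ((M * N) i j).IsHomogeneous (d + e) :=
  isHomogeneous_dotProduct (hM i) fun k => hN k j

end Homogeneous

/-! ### The family `Σ̂` -/

/-- The coordinates `S`, `t` of the base of `ρ_Σ`. -/
inductive SigmaBase : Type
  | s11 | s12 | s13 | s22 | s23 | s33 | t1 | t2 | t3

/-- The projective coordinates `p`, `p₄`, `q`, `r`, `u` of `Σ̂`. -/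
inductive SigmaFibre : Type
  | p1 | p2 | p3 | p4 | q1 | q2 | q3 | r | u

namespace Sigma

open MvPolynomial Matrix SigmaBase SigmaFibre

/-- The ring `ℂ[S, t][p, p₄, q, r, u]`. -/
abbrev Poly : Type := MvPolynomial SigmaFibre (MvPolynomial SigmaBase ℂ)

/-- The base coordinate `b`, as an element of `Poly`. -/
noncomputable def c (b : SigmaBase) : Poly := C (X b)

noncomputable def vecP : Fin 3 → Poly := ![X p1, X p2, X p3]

noncomputable def vecQ : Fin 3 → Poly := ![X q1, X q2, X q3]

noncomputable def vecT : Fin 3 → Poly := ![c t1, c t2, c t3]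

noncomputable def matS : Matrix (Fin 3) (Fin 3) Poly :=
  !![c s11, c s12, c s13;
     c s12, c s22, c s23;
     c s13, c s23, c s33]

noncomputable def matA : Matrix (Fin 3) (Fin 3) Poly :=
  !![0, -X q3, X q2;
     X q3, 0, -X q1;
     -X q2, X q1, 0]

/-- The nine polynomials defining `Σ`:
`ᵗp q`, `(r I + A S) p + p₄ A t`, `ᵗp S p + p₄ ᵗp t`, `u p - (r I - A S) A t` and
`u p₄ + (r² + ᵗq S† q)`. -/
noncomputable def equations : Set Poly :=
  {vecP ⬝ᵥ vecQ,
    vecP ⬝ᵥ (matS *ᵥ vecP) + X p4 * (vecP ⬝ᵥ vecT),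
    X u * X p4 + (X r ^ 2 + vecQ ⬝ᵥ (matS.adjugate *ᵥ vecQ))} ∪
  Set.range (((X r : Poly) • (1 : Matrix (Fin 3) (Fin 3) Poly) + matA * matS) *ᵥ vecP +
    (X p4 : Poly) • (matA *ᵥ vecT)) ∪
  Set.range ((X u : Poly) • vecP -
    ((X r : Poly) • (1 : Matrix (Fin 3) (Fin 3) Poly) - matA * matS) *ᵥ (matA *ᵥ vecT))

theorem isHomogeneous_c (b : SigmaBase) : (c b).IsHomogeneous 0 := isHomogeneous_C _ _

theorem isHomogeneous_vecP (i : Fin 3) : (vecP i).IsHomogeneous 1 := by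
  fin_cases i <;> exact isHomogeneous_X _ _

theorem isHomogeneous_vecQ (i : Fin 3) : (vecQ i).IsHomogeneous 1 := by
  fin_cases i <;> exact isHomogeneous_X _ _

theorem isHomogeneous_vecT (i : Fin 3) : (vecT i).IsHomogeneous 0 := by
  fin_cases i <;> exact isHomogeneous_c _

theorem isHomogeneous_matS (i j : Fin 3) : (matS i j).IsHomogeneous 0 := by
  fin_cases i <;> fin_cases j <;> exact isHomogeneous_c _

theorem isHomogeneous_adjugate (i j : Fin 3) : (matS.adjugate i j).IsHomogeneous 0 := by
  obtain ⟨M, hM⟩ : ∃ M : Matrix (Fin 3) (Fin 3) (MvPolynomial SigmaBase ℂ),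
      matS = (C : _ →+* Poly).mapMatrix M :=
    ⟨!![X s11, X s12, X s13; X s12, X s22, X s23; X s13, X s23, X s33], by
      ext i j : 2
      fin_cases i <;> fin_cases j <;> rfl⟩
  rw [hM, ← RingHom.map_adjugate]
  exact isHomogeneous_C _ _

theorem isHomogeneous_matA (i j : Fin 3) : (matA i j).IsHomogeneous 1 := by
  fin_cases i <;> fin_cases j <;>
    first
    | exact isHomogeneous_zero _ _ _
    | exact isHomogeneous_X _ _
    | exact (isHomogeneous_X _ _).neg

theorem isHomogeneous_rI (i j : Fin 3) :
    (((X r : Poly) • (1 : Matrix (Fin 3) (Fin 3) Poly)) i j).IsHomogeneous 1 := by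
  rw [Matrix.smul_apply, Matrix.one_apply, smul_eq_mul]
  split_ifs
  · simpa using isHomogeneous_X (MvPolynomial SigmaBase ℂ) r
  · simpa using isHomogeneous_zero SigmaFibre (MvPolynomial SigmaBase ℂ) 1

theorem isHomogeneous_equations (f : Poly) (hf : f ∈ equations) : f.IsHomogeneous 2 := by
  have hAS := isHomogeneous_mul isHomogeneous_matA isHomogeneous_matS
  have hAt := isHomogeneous_mulVec isHomogeneous_matA isHomogeneous_vecT
  rcases hf with ((rfl | rfl | rfl) | ⟨i, rfl⟩) | ⟨i, rfl⟩
  · exact isHomogeneous_dotProduct isHomogeneous_vecP isHomogeneous_vecQ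
  · refine IsHomogeneous.add (n := 2) (isHomogeneous_dotProduct (d := 1) (e := 0 + 1)
      isHomogeneous_vecP (isHomogeneous_mulVec isHomogeneous_matS isHomogeneous_vecP))
      ((isHomogeneous_X _ _).mul (isHomogeneous_dotProduct isHomogeneous_vecP isHomogeneous_vecT))
  · exact ((isHomogeneous_X _ _).mul (isHomogeneous_X _ _)).add
      ((isHomogeneous_X_pow _ _).add (isHomogeneous_dotProduct isHomogeneous_vecQ
        (isHomogeneous_mulVec isHomogeneous_adjugate isHomogeneous_vecQ)))
  · exact (isHomogeneous_mulVec (fun i j => (isHomogeneous_rI i j).add (hAS i j))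
      isHomogeneous_vecP i).add ((isHomogeneous_X _ _).mul (hAt i))
  · exact ((isHomogeneous_X _ _).mul (isHomogeneous_vecP i)).sub
      (isHomogeneous_mulVec (fun i j => (isHomogeneous_rI i j).sub (hAS i j)) hAt i)

/-- The ideal of `Σ`, which is homogeneous in `p`, `p₄`, `q`, `r`, `u`. -/
noncomputable def ideal :
    HomogeneousIdeal (homogeneousSubmodule SigmaFibre (MvPolynomial SigmaBase ℂ)) :=
  ⟨Ideal.span equations, Ideal.homogeneous_span _ _ fun f hf => ⟨2, isHomogeneous_equations f hf⟩⟩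

end Sigma

/-- The affine space `𝔸(S, t)`. -/
noncomputable def sigmaBase : Over (Spec (CommRingCat.of ℂ)) := affineSpace SigmaBase

/-- The variety `Σ̂` in `𝔸(S, t) × ℙ(p, p₄, q, r, u)`. -/
noncomputable def sigmaHat : Over (Spec (CommRingCat.of ℂ)) := family Sigma.ideal

/-- The natural projection `ρ_Σ : Σ̂ ⟶ 𝔸(S, t)`. -/
noncomputable def rhoSigma : sigmaHat ⟶ sigmaBase := family.proj Sigma.ideal

/-! ### The family `Υ̂` -/

/-- The coordinates `z`, `sᵢ`, `tⱼ` of the base of `ρ_Υ`. -/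
inductive UpsilonBase : Type
  | z | s1 | s2 | s3 | s4 | t1 | t2 | t3 | t4

/-- The projective coordinates of `Υ̂`. -/
inductive UpsilonFibre : Type
  | x1 | x2 | y1 | y2 | p1 | p2 | p3 | p4 | u

namespace Upsilon

open MvPolynomial Matrix UpsilonBase UpsilonFibre

/-- The ring `ℂ[z, sᵢ, tⱼ][x₁, x₂, y₁, y₂, p₁, p₂, p₃, p₄, u]`. -/
abbrev Poly : Type := MvPolynomial UpsilonFibre (MvPolynomial UpsilonBase ℂ)

/-- The base coordinate `b`, as an element of `Poly`. -/
noncomputable def c (b : UpsilonBase) : Poly := C (X b)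

/-- The constant `1/2`. -/
noncomputable def half : Poly := C (C (1 / 2))

noncomputable def vecS : Fin 4 → Poly := ![c s1, c s2, c s3, c s4]

noncomputable def vecT : Fin 4 → Poly := ![c t1, c t2, c t3, c t4]

noncomputable def matN : Matrix (Fin 2) (Fin 4) Poly :=
  !![X y1, X y2, c z * X x1, c z * X x2;
     X x1, X x2, X y1, X y2]

/-- The `2 × 2` minor of `matN` in the columns `i`, `j` (numbered from `0`). -/
noncomputable def minor (i j : Fin 4) : Poly := matN 0 i * matN 1 j - matN 0 j * matN 1 i

/-- The vector `(Δ₁₂, Δ₁₃, Δ₂₃, Δ₂₄)` of minors of `matN`. -/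
noncomputable def vecD : Fin 4 → Poly := ![minor 0 1, minor 0 2, minor 1 2, minor 1 3]

noncomputable def A12 : Poly := X p4 * c t1 - X p2 * c s1

noncomputable def B11 : Poly := X p2 * c s2 - X p4 * c t2

noncomputable def B12 : Poly := half * (X p2 * c s3 - X p4 * c t3)

noncomputable def B22 : Poly := X p2 * c s4 - X p4 * c t4

/-- The `5 × 5` skew-symmetric matrix whose `4 × 4` Pfaffians are five of the equations. -/
noncomputable def matK : Matrix (Fin 5) (Fin 5) Poly :=
  let U : Matrix (Fin 5) (Fin 5) Poly :=
    !![0, X x1, X x2, X y1, X y2;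
       0, 0, -X p1, -B22, X p3 + B12;
       0, 0, 0, -X p3 + B12, -B11;
       0, 0, 0, 0, -(c z * X p1) - A12;
       0, 0, 0, 0, 0]
  U - Uᵀ

/-- The Pfaffian of the skew-symmetric `4 × 4` submatrix of `matK` with rows and columns
`i < j < k < l`. -/
noncomputable def pfaffian (i j k l : Fin 5) : Poly :=
  matK i j * matK k l - matK i k * matK j l + matK i l * matK j k

noncomputable def matM1 : Matrix (Fin 4) (Fin 4) Poly :=
  let U : Matrix (Fin 4) (Fin 4) Poly :=
    !![0, -X x1 ^ 2, -(X x1 * X x2), -X x2 ^ 2;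
       0, 0, -(X x1 * X y1), -(X x1 * X y2) - X x2 * X y1;
       0, 0, 0, -(X x2 * X y2);
       0, 0, 0, 0]
  U - Uᵀ

noncomputable def matM3 : Matrix (Fin 4) (Fin 4) Poly :=
  let U : Matrix (Fin 4) (Fin 4) Poly :=
    !![0, X x1 * X y1, half * (X x1 * X y2 + X x2 * X y1), X x2 * X y2;
       0, 0, half * (X y1 ^ 2 + c z * X x1 ^ 2), X y1 * X y2 + c z * (X x1 * X x2);
       0, 0, 0, half * (X y2 ^ 2 + c z * X x2 ^ 2);
       0, 0, 0, 0]
  U - Uᵀ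

/-- The nine polynomials defining `Υ`. -/
noncomputable def equations : Set Poly :=
  {X u * X p2 - vecT ⬝ᵥ vecD, X u * X p4 - vecS ⬝ᵥ vecD} ∪
  {pfaffian 0 1 2 3, pfaffian 0 1 2 4, pfaffian 0 1 3 4, pfaffian 0 2 3 4, pfaffian 1 2 3 4} ∪
  {X p1 * X u + vecT ⬝ᵥ (matM1 *ᵥ vecS), X p3 * X u + vecT ⬝ᵥ (matM3 *ᵥ vecS)}

theorem isHomogeneous_c (b : UpsilonBase) : (c b).IsHomogeneous 0 := isHomogeneous_C _ _

theorem isHomogeneous_X_mul_c (v : UpsilonFibre) (b : UpsilonBase) :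
    (X v * c b : Poly).IsHomogeneous 1 :=
  (isHomogeneous_X _ v).mul (isHomogeneous_c b)

theorem isHomogeneous_X_mul_X (v w : UpsilonFibre) : (X v * X w : Poly).IsHomogeneous 2 :=
  (isHomogeneous_X _ v).mul (isHomogeneous_X _ w)

theorem isHomogeneous_c_mul {d : ℕ} (b : UpsilonBase) {f : Poly} (hf : f.IsHomogeneous d) :
    (c b * f).IsHomogeneous d := by
  simpa using (isHomogeneous_c b).mul hf

theorem isHomogeneous_half_mul {d : ℕ} {f : Poly} (hf : f.IsHomogeneous d) :
    (half * f).IsHomogeneous d :=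
  hf.C_mul _

theorem isHomogeneous_vecS (i : Fin 4) : (vecS i).IsHomogeneous 0 := by
  fin_cases i <;> exact isHomogeneous_c _

theorem isHomogeneous_vecT (i : Fin 4) : (vecT i).IsHomogeneous 0 := by
  fin_cases i <;> exact isHomogeneous_c _

theorem isHomogeneous_matN (i : Fin 2) (j : Fin 4) : (matN i j).IsHomogeneous 1 := by
  fin_cases i <;> fin_cases j <;>
    first
    | exact isHomogeneous_X _ _
    | exact isHomogeneous_c_mul _ (isHomogeneous_X _ _)

theorem isHomogeneous_vecD (i : Fin 4) : (vecD i).IsHomogeneous 2 := by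
  have h (i j) : (minor i j).IsHomogeneous 2 :=
    ((isHomogeneous_matN _ _).mul (isHomogeneous_matN _ _)).sub
      ((isHomogeneous_matN _ _).mul (isHomogeneous_matN _ _))
  fin_cases i <;> exact h _ _

theorem isHomogeneous_sub_transpose {n : Type} {d : ℕ} {U : Matrix n n Poly}
    (hU : ∀ i j, (U i j).IsHomogeneous d) (i j : n) : ((U - Uᵀ) i j).IsHomogeneous d :=
  (hU i j).sub (hU j i)

theorem isHomogeneous_matK (i j : Fin 5) : (matK i j).IsHomogeneous 1 := by
  have hA12 : A12.IsHomogeneous 1 := (isHomogeneous_X_mul_c _ _).sub (isHomogeneous_X_mul_c _ _)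
  have hB11 : B11.IsHomogeneous 1 := (isHomogeneous_X_mul_c _ _).sub (isHomogeneous_X_mul_c _ _)
  have hB22 : B22.IsHomogeneous 1 := (isHomogeneous_X_mul_c _ _).sub (isHomogeneous_X_mul_c _ _)
  have hB12 : B12.IsHomogeneous 1 :=
    isHomogeneous_half_mul ((isHomogeneous_X_mul_c _ _).sub (isHomogeneous_X_mul_c _ _))
  refine isHomogeneous_sub_transpose (fun i j => ?_) i j
  fin_cases i <;> fin_cases j <;> simp <;>
    with_reducible_and_instances first
    | exact isHomogeneous_zero _ _ _
    | exact isHomogeneous_X _ _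
    | exact (isHomogeneous_X _ _).neg
    | exact hB22.neg
    | exact hB11.neg
    | exact (isHomogeneous_X _ _).add hB12
    | exact (isHomogeneous_X _ _).neg.add hB12
    | exact (isHomogeneous_c_mul _ (isHomogeneous_X _ _)).neg.sub hA12

theorem isHomogeneous_pfaffian (i j k l : Fin 5) : (pfaffian i j k l).IsHomogeneous 2 := by
  have h (i j k l) : (matK i j * matK k l).IsHomogeneous 2 :=
    (isHomogeneous_matK i j).mul (isHomogeneous_matK k l)
  exact ((h _ _ _ _).sub (h _ _ _ _)).add (h _ _ _ _)

theorem isHomogeneous_matM1 (i j : Fin 4) : (matM1 i j).IsHomogeneous 2 := by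
  refine isHomogeneous_sub_transpose (fun i j => ?_) i j
  fin_cases i <;> fin_cases j <;> simp <;>
    with_reducible_and_instances first
    | exact isHomogeneous_zero _ _ _
    | exact (isHomogeneous_X_pow _ _).neg
    | exact (isHomogeneous_X_mul_X _ _).neg
    | exact (isHomogeneous_X_mul_X _ _).neg.sub (isHomogeneous_X_mul_X _ _)

theorem isHomogeneous_matM3 (i j : Fin 4) : (matM3 i j).IsHomogeneous 2 := by
  refine isHomogeneous_sub_transpose (fun i j => ?_) i j
  fin_cases i <;> fin_cases j <;> simp <;>
    with_reducible_and_instances first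
    | exact isHomogeneous_zero _ _ _
    | exact isHomogeneous_X_mul_X _ _
    | exact isHomogeneous_half_mul ((isHomogeneous_X_mul_X _ _).add (isHomogeneous_X_mul_X _ _))
    | exact (isHomogeneous_X_mul_X _ _).add (isHomogeneous_c_mul _ (isHomogeneous_X_mul_X _ _))
    | exact isHomogeneous_half_mul
        ((isHomogeneous_X_pow _ _).add (isHomogeneous_c_mul _ (isHomogeneous_X_pow _ _)))

theorem isHomogeneous_equations (f : Poly) (hf : f ∈ equations) : f.IsHomogeneous 2 := by
  have hD {v : Fin 4 → Poly} (hv : ∀ i, (v i).IsHomogeneous 0) :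
      (v ⬝ᵥ vecD).IsHomogeneous 2 := by
    simpa using isHomogeneous_dotProduct hv isHomogeneous_vecD
  have hM {M : Matrix (Fin 4) (Fin 4) Poly} (hM : ∀ i j, (M i j).IsHomogeneous 2) :
      (vecT ⬝ᵥ (M *ᵥ vecS)).IsHomogeneous 2 := by
    simpa using isHomogeneous_dotProduct isHomogeneous_vecT
      (isHomogeneous_mulVec hM isHomogeneous_vecS)
  rcases hf with ((rfl | rfl) | rfl | rfl | rfl | rfl | rfl) | rfl | rfl
  · exact (isHomogeneous_X_mul_X _ _).sub (hD isHomogeneous_vecT)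
  · exact (isHomogeneous_X_mul_X _ _).sub (hD isHomogeneous_vecS)
  · exact isHomogeneous_pfaffian _ _ _ _
  · exact isHomogeneous_pfaffian _ _ _ _
  · exact isHomogeneous_pfaffian _ _ _ _
  · exact isHomogeneous_pfaffian _ _ _ _
  · exact isHomogeneous_pfaffian _ _ _ _
  · exact (isHomogeneous_X_mul_X _ _).add (hM isHomogeneous_matM1)
  · exact (isHomogeneous_X_mul_X _ _).add (hM isHomogeneous_matM3)

/-- The ideal of `Υ`, which is homogeneous in `x₁`, `x₂`, `y₁`, `y₂`, `p₁`, `p₂`, `p₃`, `p₄`,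
`u`. -/
noncomputable def ideal :
    HomogeneousIdeal (homogeneousSubmodule UpsilonFibre (MvPolynomial UpsilonBase ℂ)) :=
  ⟨Ideal.span equations, Ideal.homogeneous_span _ _ fun f hf => ⟨2, isHomogeneous_equations f hf⟩⟩

end Upsilon

/-- The affine space `𝔸(z, sᵢ, tⱼ)`. -/
noncomputable def upsilonBase : Over (Spec (CommRingCat.of ℂ)) := affineSpace UpsilonBase

/-- The variety `Υ̂` in `𝔸(z, sᵢ, tⱼ) × ℙ(x₁, x₂, y₁, y₂, p₁, p₂, p₃, p₄, u)`. -/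
noncomputable def upsilonHat : Over (Spec (CommRingCat.of ℂ)) := family Upsilon.ideal

/-- The natural projection `ρ_Υ : Υ̂ ⟶ 𝔸(z, sᵢ, tⱼ)`. -/
noncomputable def rhoUpsilon : upsilonHat ⟶ upsilonBase := family.proj Upsilon.ideal

end QuadricFamily

/-! The special fibres are told apart by dimension and by a multiplicity structure. Over the origin
the equations of $\widehat\Upsilon$ become $p_3^2=0$, $y_ip_3=0$, $x_ip_3+y_ip_1=0$ and $up_j=0$.
This fibre contains the $\mathbb P^5$ given by $p_1=p_3=u=0$. On the chart $p_1\ne0$ it is $\{u=0,\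
y_i=-x_ip_3,\ p_3^2=0\}$ with $p_1=1$, a four-dimensional affine space with a double structure.

For $a\ne0$ the fibre of $\widehat\Sigma$ has dimension less than 5. Where some $p_i=1$, all
coordinates are polynomials in five of them, and ${}^tpSp+p_4\,{}^tpt=0$ is a nontrivial relation
among those five. Where $p=0$, the equation for $up_4$ is such a relation. This is
`Sigma.not_hasPointOfDegree`, against `Upsilon.hasPointOfDegree`.

For $a=0$ the fibre of $\widehat\Sigma$ is $\{{}^tpq=0,\ rp=up=0,\ up_4+r^2=0\}$. It is an affine
space of dimension 5 on each chart $p_i\ne0$ and of dimension 4 on $u\ne0$. What remains lies in the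
$\mathbb P^3$ with coordinates $p_4,q_1,q_2,q_3$, so the fibre is smooth at every point of dimension
at least 4. Infinitesimal lifting then holds there, whereas it fails at the generic point of the
double component of the other fibre. This is `Sigma.not_hasObstructedPointOfDegree`, against
`Upsilon.hasObstructedPointOfDegree`.

Both properties are phrased through morphisms from spectra of $\mathbb C$-algebras, which makes them
visibly invariant under isomorphism. Minimality of a field-valued point means that the field is the
residue field, so its transcendence degree is the dimension of the closure of the point. The
statement on families follows, since $\psi$ carries some closed point to the origin and matches the
fibres. -/

open CategoryTheory AlgebraicGeometry

namespace QuadricFamily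

attribute [local instance] MvPolynomial.gradedAlgebra

/-! ### Degree-zero localizations of a graded algebra. -/

section GradedRing

open HomogeneousLocalization

variable {A Q F : Type*} [CommRing A] [CommRing Q] [Algebra A Q] (𝒬 : ℕ → Submodule A Q)
  [GradedAlgebra 𝒬] {x : F → Q} (hx : ∀ i, x i ∈ 𝒬 1)

theorem val_fromZeroRingHom (i : F) (q : 𝒬 0) :
    (fromZeroRingHom 𝒬 (Submonoid.powers (x i)) q).val =
      algebraMap Q (Localization.Away (x i)) q := by
  rw [← Localization.mk_one_eq_algebraMap]
  rfl

theorem away_mk_eq_zero (i : F) (n : ℕ) {q : Q} (hq : q ∈ 𝒬 (n • 1)) (h : q = 0) :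
    Away.mk 𝒬 (hx i) n q hq = 0 := by
  subst h
  apply HomogeneousLocalization.val_injective
  rw [Away.val_mk, HomogeneousLocalization.val_zero, Localization.mk_zero]

theorem away_mk_self (i : F) (h : x i ∈ 𝒬 (1 • 1)) : Away.mk 𝒬 (hx i) 1 (x i) h = 1 := by
  apply HomogeneousLocalization.val_injective
  rw [Away.val_mk, HomogeneousLocalization.val_one, ← Localization.mk_one, Localization.mk_eq_mk_iff,
    Localization.r_iff_exists]
  exact ⟨1, by simp⟩

/-- Substituting $x_j/x_i$ into a form of degree $n$ divides each monomial by $x_i^n$. This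
identifies the explicit substitution with the abstract elements of the homogeneous localization. -/
theorem val_eval₂_fromZeroRingHom (i : F) {n : ℕ} {f : MvPolynomial F A} (hf : f.IsHomogeneous n)
    (h : ∀ j, x j ∈ 𝒬 (1 • 1)) :
    (MvPolynomial.eval₂Hom ((fromZeroRingHom 𝒬 (Submonoid.powers (x i))).comp
      (algebraMap A (𝒬 0))) (fun j => Away.mk 𝒬 (hx i) 1 (x j) (h j)) f).val =
      Localization.mk (MvPolynomial.aeval x f) (⟨x i ^ n, n, rfl⟩ : Submonoid.powers (x i)) := by
  set y : Submonoid.powers (x i) := ⟨x i, 1, pow_one _⟩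
  set ψ := MvPolynomial.eval₂Hom ((fromZeroRingHom 𝒬 (Submonoid.powers (x i))).comp
      (algebraMap A (𝒬 0))) (fun j => Away.mk 𝒬 (hx i) 1 (x j) (h j))
  have hval : (algebraMap (Away 𝒬 (x i)) (Localization.Away (x i))).comp ψ =
      MvPolynomial.eval₂Hom ((algebraMap Q (Localization.Away (x i))).comp (algebraMap A Q))
        (fun j => Localization.mk (x j) y) := by
    apply MvPolynomial.ringHom_ext
    · intro b
      simp only [ψ, RingHom.comp_apply, MvPolynomial.coe_eval₂Hom, MvPolynomial.eval₂_C,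
        HomogeneousLocalization.algebraMap_apply, val_fromZeroRingHom]
      rfl
    · intro j
      simp [ψ, y]
  have h1 := congrArg (fun g => g f) hval
  simp only [RingHom.comp_apply, HomogeneousLocalization.algebraMap_apply] at h1
  rw [h1]
  have hx : Localization.mk (MvPolynomial.aeval x f) (⟨x i ^ n, n, rfl⟩ :
      Submonoid.powers (x i)) = algebraMap Q (Localization.Away (x i))
        (MvPolynomial.aeval x f) * (Localization.mk 1 y) ^ n := by
    rw [← Localization.mk_one_eq_algebraMap, Localization.mk_pow, Localization.mk_mul]
    congr 1
    · simp
    · ext; simp [y]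
  rw [hx, MvPolynomial.aeval_eq_eval₂Hom, MvPolynomial.coe_eval₂Hom, MvPolynomial.coe_eval₂Hom,
    MvPolynomial.eval₂_eq, MvPolynomial.eval₂_eq, map_sum, Finset.sum_mul]
  refine Finset.sum_congr rfl fun d hd => ?_
  have hd' : ∑ j ∈ d.support, d j = n := by
    have := hf (MvPolynomial.mem_support_iff.1 hd)
    simpa [Finsupp.weight_apply, Finsupp.sum] using this
  rw [map_mul, RingHom.comp_apply, mul_assoc, map_prod]
  congr 1
  rw [← hd', ← Finset.prod_pow_eq_pow_sum, ← Finset.prod_mul_distrib]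
  refine Finset.prod_congr rfl fun j _ => ?_
  rw [map_pow, ← mul_pow, ← Localization.mk_one_eq_algebraMap, Localization.mk_mul]
  simp

theorem exists_awayHom {R : Type*} [CommRing R] (e : Q →+* R) (i : F) (he : e (x i) = 1) :
    ∃ θ : Away 𝒬 (x i) →+* R,
      (∀ q : 𝒬 0, θ (fromZeroRingHom 𝒬 (Submonoid.powers (x i)) q) = e q) ∧
      ∀ q (hq : q ∈ 𝒬 (1 • 1)), θ (Away.mk 𝒬 (hx i) 1 q hq) = e q := by
  have hu : IsUnit (e (x i)) := by simp [he]
  refine ⟨(IsLocalization.Away.lift (S := Localization.Away (x i)) (x i) hu).comp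
    (algebraMap (Away 𝒬 (x i)) (Localization.Away (x i))), fun q => ?_, fun q hq => ?_⟩
  · rw [RingHom.comp_apply, HomogeneousLocalization.algebraMap_apply, val_fromZeroRingHom,
      IsLocalization.Away.lift_eq]
  · rw [RingHom.comp_apply, HomogeneousLocalization.algebraMap_apply, Away.val_mk]
    have : Localization.mk q (⟨x i ^ 1, 1, rfl⟩ : Submonoid.powers (x i)) *
      algebraMap Q (Localization.Away (x i)) (x i) =
        algebraMap Q (Localization.Away (x i)) q := by
      rw [← Localization.mk_one_eq_algebraMap, ← Localization.mk_one_eq_algebraMap,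
        Localization.mk_mul, Localization.mk_eq_mk_iff, Localization.r_iff_exists]
      exact ⟨1, by simp; ring⟩
    have h2 := congrArg (IsLocalization.Away.lift (S := Localization.Away (x i))
      (x i) hu) this
    rw [map_mul, IsLocalization.Away.lift_eq, IsLocalization.Away.lift_eq] at h2
    simpa [he] using h2

end GradedRing

/-! ### Standard affine charts of the family and dehomogenization. -/

section Chart

open MvPolynomial HomogeneousLocalization

variable {B F : Type} (I : HomogeneousIdeal (homogeneousSubmodule F (MvPolynomial B ℂ)))

/-- The grading of the homogeneous coordinate ring of the family defined by `I`. -/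
noncomputable abbrev coordGrading :=
  quotientGrading (homogeneousSubmodule F (MvPolynomial B ℂ)) I

/-- The homogeneous coordinate ring of the family defined by `I`. -/
abbrev CoordRing : Type := MvPolynomial F (MvPolynomial B ℂ) ⧸ I.toIdeal

/-- The class of the projective coordinate `X i`. -/
noncomputable def coord (i : F) : CoordRing I :=
  Ideal.Quotient.mk I.toIdeal (X i)

theorem mk_mem_coordGrading {n : ℕ} {f : MvPolynomial F (MvPolynomial B ℂ)}
    (hf : f.IsHomogeneous n) : Ideal.Quotient.mk I.toIdeal f ∈ coordGrading I n :=
  ⟨f, hf, rfl⟩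

theorem coord_mem (i : F) : coord I i ∈ coordGrading I 1 :=
  mk_mem_coordGrading I (isHomogeneous_X _ i)

/-- The coordinate ring of the chart `X i ≠ 0`. -/
abbrev ChartRing (i : F) : Type := Away (coordGrading I) (coord I i)

/-- The coordinate `X j / X i` on the chart `X i ≠ 0`. -/
noncomputable def chartCoord (i j : F) : ChartRing I i :=
  Away.mk (coordGrading I) (coord_mem I i) 1 (coord I j) (by simpa using coord_mem I j)

/-- The base coordinates as functions on the chart. -/
noncomputable def chartBase (i : F) : MvPolynomial B ℂ →+* ChartRing I i :=
  (fromZeroRingHom (coordGrading I) _).comp (algebraMap (MvPolynomial B ℂ) (coordGrading I 0))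

/-- Dehomogenization with respect to `X i`. -/
noncomputable def dehomogenize (i : F) : MvPolynomial F (MvPolynomial B ℂ) →+* ChartRing I i :=
  eval₂Hom (chartBase I i) (chartCoord I i)

theorem dehomogenize_X (i j : F) : dehomogenize I i (X j) = chartCoord I i j := by
  simp [dehomogenize]

theorem aeval_coord (f : MvPolynomial F (MvPolynomial B ℂ)) :
    aeval (coord I) f = Ideal.Quotient.mk I.toIdeal f := by
  have : aeval (coord I) = Ideal.Quotient.mkₐ (MvPolynomial B ℂ) I.toIdeal := by
    ext j
    simp [coord]
  rw [this]
  rfl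

theorem dehomogenize_of_isHomogeneous (i : F) {n : ℕ} {f : MvPolynomial F (MvPolynomial B ℂ)}
    (hf : f.IsHomogeneous n) :
    dehomogenize I i f = Away.mk (coordGrading I) (coord_mem I i) n (Ideal.Quotient.mk I.toIdeal f)
      (by simpa using mk_mem_coordGrading I hf) := by
  apply HomogeneousLocalization.val_injective
  rw [Away.val_mk, ← aeval_coord]
  exact val_eval₂_fromZeroRingHom (coordGrading I) (coord_mem I) i hf _

theorem dehomogenize_surjective (i : F) : Function.Surjective (dehomogenize I i) := by
  intro y
  obtain ⟨n, a, ha, rfl⟩ := Away.mk_surjective (coordGrading I) (coord_mem I i) y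
  obtain ⟨f, hf, rfl⟩ := ha
  rw [smul_eq_mul, mul_one] at hf
  exact ⟨f, dehomogenize_of_isHomogeneous I i hf⟩

theorem dehomogenize_eq_zero (i : F) {f : MvPolynomial F (MvPolynomial B ℂ)}
    (hf : f ∈ I.toIdeal) : dehomogenize I i f = 0 := by
  classical
  -- The formula for dehomogenization needs a form, so $f$ is split into its homogeneous components,
  -- which lie in the ideal because it is homogeneous.
  rw [← DirectSum.sum_support_decompose (homogeneousSubmodule F (MvPolynomial B ℂ)) f, map_sum]
  refine Finset.sum_eq_zero fun n _ => ?_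
  have hn := I.isHomogeneous n hf
  rw [dehomogenize_of_isHomogeneous I i (n := n) (DirectSum.decompose (homogeneousSubmodule F (MvPolynomial B ℂ)) f n).2]
  exact away_mk_eq_zero _ (coord_mem I) i n _ (Ideal.Quotient.eq_zero_iff_mem.2 hn)

theorem chartCoord_self (i : F) : chartCoord I i i = 1 :=
  away_mk_self _ (coord_mem I) i _

variable {R : Type} [CommRing R] [Algebra ℂ R]

/-- Evaluation at the point of `R^F` with coordinates `v` over the point `a` of the base. -/
noncomputable def evalAt (a : B → ℂ) (v : F → R) : MvPolynomial F (MvPolynomial B ℂ) →+* R :=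
  eval₂Hom ((algebraMap ℂ R).comp (eval a)) v

@[simp] theorem evalAt_X (a : B → ℂ) (v : F → R) (j : F) : evalAt a v (X j) = v j := by
  simp [evalAt]

@[simp] theorem evalAt_C (a : B → ℂ) (v : F → R) (b : MvPolynomial B ℂ) :
    evalAt a v (C b) = algebraMap ℂ R (eval a b) := by
  simp [evalAt]

theorem comp_evalAt {R' : Type} [CommRing R'] [Algebra ℂ R'] (σ : R →ₐ[ℂ] R')
    (a : B → ℂ) (v : F → R) :
    (σ : R →+* R').comp (evalAt a v) = evalAt a (fun j => σ (v j)) := by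
  apply MvPolynomial.ringHom_ext
  · intro b; simp
  · intro j; simp

theorem exists_chartHom (a : B → ℂ) (v : F → R) (i : F) (hi : v i = 1)
    (hI : ∀ f ∈ I.toIdeal, evalAt a v f = 0) :
    ∃ θ : ChartRing I i →+* R, θ.comp (dehomogenize I i) = evalAt a v := by
  obtain ⟨θ, h0, h1⟩ := exists_awayHom (coordGrading I) (coord_mem I)
    (Ideal.Quotient.lift I.toIdeal (evalAt a v) hI) i (by simp [coord, hi])
  refine ⟨θ, MvPolynomial.ringHom_ext (fun b => ?_) fun j => ?_⟩
  · rw [RingHom.comp_apply, dehomogenize, coe_eval₂Hom, eval₂_C]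
    exact (h0 _).trans (Ideal.Quotient.lift_mk I.toIdeal (evalAt a v) hI)
  · rw [RingHom.comp_apply, dehomogenize_X]
    exact (h1 _ _).trans (Ideal.Quotient.lift_mk I.toIdeal (evalAt a v) hI)

theorem iSup_basicOpen_coord : ⨆ i, Proj.basicOpen (coordGrading I) (coord I i) = ⊤ := by
  refine Proj.iSup_basicOpen_eq_top' _ _ (fun i => ⟨1, coord_mem I i⟩) ?_
  rw [eq_top_iff]
  rintro y -
  obtain ⟨f, rfl⟩ := Ideal.Quotient.mk_surjective y
  induction f using MvPolynomial.induction_on with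
  | C b =>
    exact Subalgebra.algebraMap_mem (Algebra.adjoin (coordGrading I 0) (Set.range (coord I)))
      (⟨_, mk_mem_coordGrading I (isHomogeneous_C F b)⟩ : coordGrading I 0)
  | add f g hf hg => rw [map_add]; exact add_mem hf hg
  | mul_X f j hf => rw [map_mul]; exact mul_mem hf (Algebra.subset_adjoin ⟨j, rfl⟩)

end Chart

/-- The spectrum of a `ℂ`-algebra, as a scheme over `ℂ`. -/
noncomputable def specOver (R : Type) [CommRing R] [Algebra ℂ R] :
    Over (Spec (CommRingCat.of ℂ)) :=
  Over.mk (Spec.map (CommRingCat.ofHom (algebraMap ℂ R)))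

/-- The morphism of spectra induced by a homomorphism of `ℂ`-algebras. -/
noncomputable def specOverMap {R R' : Type} [CommRing R] [Algebra ℂ R] [CommRing R'] [Algebra ℂ R']
    (σ : R →ₐ[ℂ] R') : specOver R' ⟶ specOver R :=
  Over.homMk (Spec.map (CommRingCat.ofHom (σ : R →+* R'))) (by
    change Spec.map _ ≫ Spec.map _ = Spec.map _
    rw [← Spec.map_comp, ← CommRingCat.ofHom_comp]
    congr 2
    exact σ.comp_algebraMap)

/-! ### Morphisms into a scheme-theoretic fibre. -/

section Fibre

universe u

variable {X Y T : Scheme.{u}} (f : X ⟶ Y) (y : Y)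

theorem comp_fiberι_comp (l : T ⟶ f.fiber y) :
    (l ≫ f.fiberι y) ≫ f = (l ≫ f.fiberToSpecResidueField y) ≫ Y.fromSpecResidueField y := by
  rw [Category.assoc, Category.assoc, f.fiber_fac]

theorem exists_comp_fiberι_eq (h : T ⟶ X) (k : T ⟶ Spec (Y.residueField y))
    (hk : h ≫ f = k ≫ Y.fromSpecResidueField y) : ∃ l : T ⟶ f.fiber y, l ≫ f.fiberι y = h :=
  ⟨Limits.pullback.lift h k hk, Limits.pullback.lift_fst _ _ _⟩

end Fibre

/-- The closed point of the spectrum of a local ring. -/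
def closedPt (R : Type) [CommRing R] [IsLocalRing R] : Spec (CommRingCat.of R) :=
  IsLocalRing.closedPoint R

/-! ### Points of a fibre in homogeneous coordinates. -/

section Points

open MvPolynomial

variable {B F : Type} (I : HomogeneousIdeal (homogeneousSubmodule F (MvPolynomial B ℂ)))
  {R : Type} [CommRing R] [Algebra ℂ R] (a : B → ℂ)

/-- The closed point `affinePoint a`, as a point of a spectrum. -/
noncomputable def specPoint : Spec (CommRingCat.of (MvPolynomial B ℂ)) := affinePoint a

theorem exists_residueField_hom : ∃ c : Spec (CommRingCat.of ℂ) ⟶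
      Spec ((Spec (CommRingCat.of (MvPolynomial B ℂ))).residueField (specPoint a)),
    c ≫ (Spec (CommRingCat.of (MvPolynomial B ℂ))).fromSpecResidueField (specPoint a) =
      Spec.map (CommRingCat.ofHom (eval a)) := by
  set f := Spec.map (CommRingCat.ofHom (eval a))
  have hf : f (IsLocalRing.closedPoint ℂ) = specPoint a := by
    refine PrimeSpectrum.ext ?_
    change Ideal.comap (eval a) (IsLocalRing.closedPoint ℂ).asIdeal = RingHom.ker (eval a)
    change Ideal.comap (eval a) (IsLocalRing.maximalIdeal ℂ) = _
    rw [IsLocalRing.maximalIdeal_eq_bot]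
    rfl
  rw [← hf]
  exact ⟨_, Scheme.descResidueField_stalkClosedPointTo_fromSpecResidueField ℂ _ f⟩

/-- The residue field at $a$ is $\mathbb C$, so a morphism over $\mathbb C$ from an affine scheme
through it can only be evaluation at $a$ followed by the structure map. -/
theorem comp_fromSpecResidueField
    (k : Spec (CommRingCat.of R) ⟶
      Spec ((Spec (CommRingCat.of (MvPolynomial B ℂ))).residueField (specPoint a)))
    (hk : (k ≫ (Spec (CommRingCat.of (MvPolynomial B ℂ))).fromSpecResidueField (specPoint a)) ≫
      Spec.map (CommRingCat.ofHom (algebraMap ℂ (MvPolynomial B ℂ))) =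
        Spec.map (CommRingCat.ofHom (algebraMap ℂ R))) :
    k ≫ (Spec (CommRingCat.of (MvPolynomial B ℂ))).fromSpecResidueField (specPoint a) =
      Spec.map (CommRingCat.ofHom ((algebraMap ℂ R).comp (eval a))) := by
  obtain ⟨c, hc⟩ := exists_residueField_hom a
  obtain ⟨ρ, hρ⟩ := Spec.map_surjective
    ((Spec (CommRingCat.of (MvPolynomial B ℂ))).fromSpecResidueField (specPoint a))
  obtain ⟨c, rfl⟩ := Spec.map_surjective c
  obtain ⟨k, rfl⟩ := Spec.map_surjective k
  rw [← hρ, ← Spec.map_comp, Spec.map_inj] at hc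
  rw [← hρ, ← Spec.map_comp, ← Spec.map_comp, Spec.map_inj] at hk
  rw [← hρ, ← Spec.map_comp, Spec.map_inj]
  have hk' (z : ℂ) : k.hom (ρ.hom (C z)) = algebraMap ℂ R z := congrArg (fun f => f.hom z) hk
  have hc' (f : MvPolynomial B ℂ) : c.hom (ρ.hom f) = eval a f := congrArg (fun g => g.hom f) hc
  have hinj : Function.Injective c.hom :=
    have : Nontrivial (CommRingCat.of ℂ) := inferInstanceAs (Nontrivial ℂ)
    RingHom.injective (R := (Spec (CommRingCat.of (MvPolynomial B ℂ))).residueField (specPoint a))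
      c.hom
  apply CommRingCat.hom_ext
  apply MvPolynomial.ringHom_ext
  · intro z
    simpa using hk' z
  · intro b
    -- Both sides have image $a_b$ in $\mathbb C$, and the residue field embeds there.
    have : ρ.hom (X b) = ρ.hom (C (a b)) := hinj (by simp [hc'])
    change k.hom (ρ.hom (X b)) = algebraMap ℂ R (eval a (X b))
    rw [this, hk', eval_X]

/-- The fibre over the point `a` of the family defined by `I`. -/
noncomputable abbrev fibreAt : Over (Spec (CommRingCat.of ℂ)) :=
  fibre (family.proj I) (affinePoint a)

variable {I a}

/-- The morphism to `Proj` underlying a point of a fibre. -/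
noncomputable def toProj (g : specOver R ⟶ fibreAt I a) :
    Spec (CommRingCat.of R) ⟶ Proj (coordGrading I) :=
  g.left ≫ (family.proj I).left.fiberι (affinePoint a)

theorem toProj_injective {g g' : specOver R ⟶ fibreAt I a} (h : toProj g = toProj g') : g = g' := by
  apply Over.OverMorphism.ext
  have : Mono ((family.proj I).left.fiberι (affinePoint a)) := inferInstance
  exact (cancel_mono ((family.proj I).left.fiberι (affinePoint a))).1 h

theorem toProj_specOverMap {R' : Type} [CommRing R'] [Algebra ℂ R'] (σ : R →ₐ[ℂ] R')
    (g : specOver R ⟶ fibreAt I a) :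
    toProj (specOverMap σ ≫ g) = Spec.map (CommRingCat.ofHom (σ : R →+* R')) ≫ toProj g := by
  simp only [toProj, Over.comp_left]
  rfl

theorem toProj_projToSpec (g : specOver R ⟶ fibreAt I a) :
    toProj g ≫ projToSpec I = Spec.map (CommRingCat.ofHom ((algebraMap ℂ R).comp (eval a))) := by
  obtain ⟨k, hk⟩ : ∃ k : Spec (CommRingCat.of R) ⟶
      Spec ((Spec (CommRingCat.of (MvPolynomial B ℂ))).residueField (specPoint a)),
      toProj g ≫ projToSpec I =
        k ≫ (Spec (CommRingCat.of (MvPolynomial B ℂ))).fromSpecResidueField (specPoint a) :=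
    ⟨_, comp_fiberι_comp (projToSpec I) (specPoint a) g.left⟩
  rw [hk]
  apply comp_fromSpecResidueField
  rw [← hk]
  exact Over.w g

theorem exists_toProj_eq (h : Spec (CommRingCat.of R) ⟶ Proj (coordGrading I))
    (hh : h ≫ projToSpec I = Spec.map (CommRingCat.ofHom ((algebraMap ℂ R).comp (eval a)))) :
    ∃ g : specOver R ⟶ fibreAt I a, toProj g = h := by
  obtain ⟨c, hc⟩ := exists_residueField_hom a
  obtain ⟨l, hl⟩ := exists_comp_fiberι_eq (projToSpec I) (specPoint a) h
    (Spec.map (CommRingCat.ofHom (algebraMap ℂ R)) ≫ c) (by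
      rw [hh, Category.assoc, hc, CommRingCat.ofHom_comp, Spec.map_comp])
  refine ⟨Over.homMk l ?_, hl⟩
  have hw : (l ≫ (projToSpec I).fiberι (specPoint a)) ≫ projToSpec I ≫
      Spec.map (CommRingCat.ofHom (algebraMap ℂ (MvPolynomial B ℂ))) =
        Spec.map (CommRingCat.ofHom (algebraMap ℂ R)) := by
    rw [hl, reassoc_of% hh, ← Spec.map_comp, ← CommRingCat.ofHom_comp, RingHom.comp_assoc]
    congr 2
    ext z
    simp
  rw [Category.assoc] at hw
  exact hw

variable (I) in
/-- The inclusion of the chart `X i ≠ 0`. -/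
noncomputable def chartι (i : F) : Spec (CommRingCat.of (ChartRing I i)) ⟶ Proj (coordGrading I) :=
  Proj.awayι (coordGrading I) (coord I i) (coord_mem I i) one_pos

instance (i : F) : IsOpenImmersion (chartι I i) :=
  inferInstanceAs (IsOpenImmersion (Proj.awayι _ _ _ _))

variable (I) in
theorem opensRange_chartι (i : F) :
    (chartι I i).opensRange = Proj.basicOpen (coordGrading I) (coord I i) :=
  Proj.opensRange_awayι _ _ _ _

theorem chartι_projToSpec (i : F) :
    chartι I i ≫ projToSpec I = Spec.map (CommRingCat.ofHom (chartBase I i)) := by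
  rw [chartι, projToSpec]
  erw [Proj.awayι_toSpecZero_assoc]
  rw [← Spec.map_comp]
  rfl

/-- The point `g` lies in the chart `X i ≠ 0`, where it has coordinates `v`. -/
def HasCoord (g : specOver R ⟶ fibreAt I a) (i : F) (v : F → R) : Prop :=
  ∃ θ : ChartRing I i →+* R, toProj g = Spec.map (CommRingCat.ofHom θ) ≫ chartι I i ∧
    θ.comp (dehomogenize I i) = evalAt a v

theorem exists_hasCoord (i : F) (v : F → R) (hi : v i = 1)
    (hI : ∀ f ∈ I.toIdeal, evalAt a v f = 0) : ∃ g : specOver R ⟶ fibreAt I a, HasCoord g i v := by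
  obtain ⟨θ, hθ⟩ := exists_chartHom I a v i hi hI
  obtain ⟨g, hg⟩ := exists_toProj_eq (I := I) (a := a)
    (Spec.map (CommRingCat.ofHom θ) ≫ chartι I i) (by
      rw [Category.assoc, chartι_projToSpec, ← Spec.map_comp, ← CommRingCat.ofHom_comp]
      congr 2
      have := congrArg (fun e : _ →+* R => e.comp C) hθ
      simpa [RingHom.comp_assoc, dehomogenize, evalAt] using this)
  exact ⟨g, θ, hg, hθ⟩

namespace HasCoord

variable {g g' : specOver R ⟶ fibreAt I a} {i : F} {v v' : F → R}

theorem apply_self (h : HasCoord g i v) : v i = 1 := by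
  obtain ⟨θ, -, hθ⟩ := h
  have := congrArg (fun e => e (X i)) hθ
  simpa [dehomogenize_X, chartCoord_self] using this.symm

theorem evalAt_eq_zero (h : HasCoord g i v) {f : MvPolynomial F (MvPolynomial B ℂ)}
    (hf : f ∈ I.toIdeal) : evalAt a v f = 0 := by
  obtain ⟨θ, -, hθ⟩ := h
  rw [← hθ, RingHom.comp_apply, dehomogenize_eq_zero I i hf, map_zero]

/-- Dehomogenization is surjective, so the coordinates determine the ring map on the chart. The
inclusion of the fibre is a monomorphism, so they determine the point as well. -/
theorem point_eq (h : HasCoord g i v) (h' : HasCoord g' i v) : g = g' := by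
  obtain ⟨θ, hg, hθ⟩ := h
  obtain ⟨θ', hg', hθ'⟩ := h'
  apply toProj_injective
  rw [hg, hg', (RingHom.cancel_right (dehomogenize_surjective I i)).1 (hθ.trans hθ'.symm)]

theorem coord_eq (h : HasCoord g i v) (h' : HasCoord g i v') : v = v' := by
  obtain ⟨θ, hg, hθ⟩ := h
  obtain ⟨θ', hg', hθ'⟩ := h'
  rw [hg, cancel_mono, Spec.map_inj] at hg'
  have : θ = θ' := congrArg CommRingCat.Hom.hom hg'
  subst this
  funext j
  simpa using congrArg (fun e => e (X j)) (hθ.symm.trans hθ')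

theorem comp (h : HasCoord g i v) {R' : Type} [CommRing R'] [Algebra ℂ R'] (σ : R →ₐ[ℂ] R') :
    HasCoord (specOverMap σ ≫ g) i (fun j => σ (v j)) := by
  obtain ⟨θ, hg, hθ⟩ := h
  refine ⟨(σ : R →+* R').comp θ, ?_, ?_⟩
  · rw [toProj_specOverMap, hg, CommRingCat.ofHom_comp, Spec.map_comp, Category.assoc]
  · rw [RingHom.comp_assoc, hθ, comp_evalAt]

end HasCoord

variable [IsLocalRing R]

/-- The closed point of the point `g` lies in the chart `X i ≠ 0`. -/
def InChart (g : specOver R ⟶ fibreAt I a) (i : F) : Prop :=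
  toProj g (closedPt R) ∈ Proj.basicOpen (coordGrading I) (coord I i)

theorem exists_inChart (g : specOver R ⟶ fibreAt I a) : ∃ i, InChart g i := by
  have := (iSup_basicOpen_coord I).ge
    (Set.mem_univ (toProj g (closedPt R)))
  exact TopologicalSpace.Opens.mem_iSup.1 this

theorem InChart.exists_hasCoord {g : specOver R ⟶ fibreAt I a} {i : F} (h : InChart g i) :
    ∃ v, HasCoord g i v := by
  -- Every point of the spectrum of a local ring specializes to the closed point, so an open set
  -- containing the image of the closed point contains the whole image.
  have hr : Set.range (toProj g) ⊆ Set.range (chartι I i) := by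
    rintro _ ⟨x, rfl⟩
    change _ ∈ (chartι I i).opensRange
    rw [opensRange_chartι]
    exact ((IsLocalRing.specializes_closedPoint x).map
      (toProj g).continuous).mem_open (Proj.basicOpen _ _).isOpen h
  obtain ⟨θ, hθ⟩ := Spec.map_surjective (IsOpenImmersion.lift (chartι I i) (toProj g) hr)
  have hg : toProj g = Spec.map θ ≫ chartι I i := by rw [hθ, IsOpenImmersion.lift_fac]
  refine ⟨fun j => θ.hom (chartCoord I i j), θ.hom, hg, ?_⟩
  have hb := toProj_projToSpec g
  rw [hg, Category.assoc, chartι_projToSpec, ← Spec.map_comp, Spec.map_inj] at hb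
  apply MvPolynomial.ringHom_ext
  · intro b
    rw [evalAt_C, RingHom.comp_apply, dehomogenize, coe_eval₂Hom, eval₂_C]
    exact congrArg (fun e => e.hom b) hb
  · intro j
    rw [evalAt_X, RingHom.comp_apply, dehomogenize_X]

theorem inChart_specOverMap {R' : Type} [CommRing R'] [Algebra ℂ R'] [IsLocalRing R']
    (σ : R →ₐ[ℂ] R') [IsLocalHom (σ : R →+* R')] (g : specOver R ⟶ fibreAt I a) (i : F) :
    InChart (specOverMap σ ≫ g) i ↔ InChart g i := by
  rw [InChart, InChart, toProj_specOverMap]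
  have : Spec.map (CommRingCat.ofHom (σ : R →+* R')) (closedPt R') =
    closedPt R := IsLocalRing.comap_closedPoint (σ : R →+* R')
  rw [Scheme.Hom.comp_apply, this]

theorem HasCoord.inChart_iff {g : specOver R ⟶ fibreAt I a} {i : F} {v : F → R}
    (h : HasCoord g i v) (j : F) : InChart g j ↔ IsUnit (v j) := by
  obtain ⟨θ, hg, hθ⟩ := h
  have hv : v j = θ (chartCoord I i j) := by
    simpa [dehomogenize_X] using (congrArg (fun e => e (X j)) hθ).symm
  rw [InChart, hg, Scheme.Hom.comp_apply]
  change _ ∈ chartι I i ⁻¹ᵁ (Proj.basicOpen (coordGrading I) (coord I j)) ↔ _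
  rw [chartι, Proj.awayι_preimage_basicOpen (coordGrading I) (coord_mem I i) one_pos
    (coord_mem I j) one_pos]
  have hloc : HomogeneousLocalization.Away.isLocalizationElem (coord_mem I i) (coord_mem I j) =
      chartCoord I i j := by
    apply HomogeneousLocalization.val_injective
    simp [HomogeneousLocalization.Away.isLocalizationElem, chartCoord]
  rw [hloc, hv]
  change ¬ (θ (chartCoord I i j) ∈ IsLocalRing.maximalIdeal R) ↔ _
  rw [IsLocalRing.mem_maximalIdeal, mem_nonunits_iff, not_not]

theorem HasCoord.inChart {g : specOver R ⟶ fibreAt I a} {i : F} {v : F → R}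
    (h : HasCoord g i v) : InChart g i :=
  (h.inChart_iff i).2 (by rw [h.apply_self]; exact isUnit_one)

/-- Coordinates of a point extend to coordinates of a local thickening. -/
theorem HasCoord.exists_lift {R' : Type} [CommRing R'] [Algebra ℂ R'] [IsLocalRing R']
    {σ : R →ₐ[ℂ] R'} [IsLocalHom (σ : R →+* R')] {g : specOver R ⟶ fibreAt I a} {i : F}
    {v : F → R'} (h : HasCoord (specOverMap σ ≫ g) i v) :
    ∃ w, HasCoord g i w ∧ (fun j => σ (w j)) = v := by
  obtain ⟨w, hw⟩ := ((inChart_specOverMap σ g i).1 h.inChart).exists_hasCoord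
  exact ⟨w, hw, (hw.comp σ).coord_eq h⟩

end Points

/-! ### Two isomorphism invariants of schemes over $\mathbb C$. -/

section Invariants

/-- A point with values in a field `K` is minimal if it does not factor through a proper subfield. -/
def IsMinimal {X : Over (Spec (CommRingCat.of ℂ))} {K : Type} [Field K] [Algebra ℂ K]
    (g : specOver K ⟶ X) : Prop :=
  ∀ (L : IntermediateField ℂ K) (h : specOver L ⟶ X), specOverMap L.val ≫ h = g → L = ⊤

theorem IsMinimal.comp_iso {X Y : Over (Spec (CommRingCat.of ℂ))} {K : Type} [Field K]
    [Algebra ℂ K] {g : specOver K ⟶ X} (hg : IsMinimal g) (e : X ≅ Y) : IsMinimal (g ≫ e.hom) := by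
  intro L h hh
  refine hg L (h ≫ e.inv) ?_
  rw [← Category.assoc, hh, Category.assoc, e.hom_inv_id, Category.comp_id]

/-- There is a point whose residue field has transcendence degree at least `n`. -/
def HasPointOfDegree (n : ℕ) (X : Over (Spec (CommRingCat.of ℂ))) : Prop :=
  ∃ (K : Type) (_ : Field K) (_ : Algebra ℂ K) (g : specOver K ⟶ X),
    (n : Cardinal) ≤ Algebra.trdeg ℂ K ∧ IsMinimal g

/-- There is a point whose residue field has transcendence degree at least `n`, such that a local
thickening of it does not extend to some further thickening. -/
def HasObstructedPointOfDegree (n : ℕ) (X : Over (Spec (CommRingCat.of ℂ))) : Prop :=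
  ∃ (K : Type) (_ : Field K) (_ : Algebra ℂ K) (g : specOver K ⟶ X),
    (n : Cardinal) ≤ Algebra.trdeg ℂ K ∧ IsMinimal g ∧
    ∃ (R : Type) (_ : CommRing R) (_ : Algebra ℂ R) (_ : IsLocalRing R)
      (R' : Type) (_ : CommRing R') (_ : Algebra ℂ R') (_ : IsLocalRing R')
      (π : R' →ₐ[ℂ] R) (σ : R →ₐ[ℂ] K) (h : specOver R ⟶ X),
      Function.Surjective π ∧ IsLocalHom (σ : R →+* K) ∧ specOverMap σ ≫ h = g ∧
        ¬ ∃ h' : specOver R' ⟶ X, specOverMap π ≫ h' = h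

theorem HasPointOfDegree.of_iso {n : ℕ} {X Y : Over (Spec (CommRingCat.of ℂ))}
    (h : HasPointOfDegree n X) (e : X ≅ Y) : HasPointOfDegree n Y := by
  obtain ⟨K, _, _, g, hK, hg⟩ := h
  exact ⟨K, _, _, g ≫ e.hom, hK, hg.comp_iso e⟩

theorem HasObstructedPointOfDegree.of_iso {n : ℕ} {X Y : Over (Spec (CommRingCat.of ℂ))}
    (h : HasObstructedPointOfDegree n X) (e : X ≅ Y) : HasObstructedPointOfDegree n Y := by
  obtain ⟨K, _, _, g, hK, hg, R, _, _, _, R', _, _, _, π, σ, h, hπ, hσ, rfl, hn⟩ := h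
  refine ⟨K, _, _, _, hK, hg.comp_iso e, R, _, _, ‹_›, R', _, _, ‹_›, π, σ, h ≫ e.hom, hπ, hσ,
    (Category.assoc _ _ _).symm, fun ⟨h', hh'⟩ => hn ⟨h' ≫ e.inv, ?_⟩⟩
  rw [← Category.assoc, hh', Category.assoc, e.hom_inv_id, Category.comp_id]

end Invariants

/-! ### Minimality in terms of coordinates. -/

section Coordinates

open MvPolynomial

variable {B F : Type} {I : HomogeneousIdeal (homogeneousSubmodule F (MvPolynomial B ℂ))}
  {K : Type} [Field K] [Algebra ℂ K] {a : B → ℂ} {g : specOver K ⟶ fibreAt I a} {i : F} {v : F → K}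

/-- The coordinates already define a point over the field they generate, and the given point factors
through it. -/
theorem HasCoord.adjoin_eq_top (h : HasCoord g i v) (hg : IsMinimal g) :
    IntermediateField.adjoin ℂ (Set.range v) = ⊤ := by
  set L := IntermediateField.adjoin ℂ (Set.range v)
  let w : F → L := fun j => ⟨v j, IntermediateField.subset_adjoin ℂ _ ⟨j, rfl⟩⟩
  have hw : (fun j => L.val (w j)) = v := rfl
  obtain ⟨g', hg'⟩ := exists_hasCoord (I := I) (a := a) i w (Subtype.ext h.apply_self) (by
    intro f hf
    apply L.val.injective
    have := congrArg (fun e => e f) (comp_evalAt L.val a w)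
    rw [map_zero, ← h.evalAt_eq_zero hf]
    exact this)
  exact hg L g' ((hg'.comp L.val).point_eq h)

theorem HasCoord.isMinimal (h : HasCoord g i v)
    (hv : IntermediateField.adjoin ℂ (Set.range v) = ⊤) : IsMinimal g := by
  rintro L g' rfl
  have hloc : IsLocalHom (L.val : L →+* K) := inferInstance
  obtain ⟨w, -, rfl⟩ := h.exists_lift
  rw [eq_top_iff, ← hv, IntermediateField.adjoin_le_iff]
  rintro _ ⟨j, rfl⟩
  exact (w j).2

end Coordinates

/-! ### Generators and transcendence degree. -/

section Fields

variable {K : Type} [Field K] [Algebra ℂ K]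

theorem isAlgebraic_adjoin_of_eq_top {S : Set K} (hS : IntermediateField.adjoin ℂ S = ⊤) :
    Algebra.IsAlgebraic (Algebra.adjoin ℂ S) K := by
  refine ⟨fun x => ?_⟩
  have hx : x ∈ IntermediateField.adjoin ℂ S := hS ▸ IntermediateField.mem_top
  obtain ⟨r, hr, s, hs, rfl⟩ := IntermediateField.mem_adjoin_iff_div.1 hx
  rw [div_eq_mul_inv]
  exact (isAlgebraic_algebraMap (⟨r, hr⟩ : Algebra.adjoin ℂ S)).mul
    (isAlgebraic_algebraMap (⟨s, hs⟩ : Algebra.adjoin ℂ S)).inv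

/-- A generating family contains a transcendence basis; with only $n$ members and transcendence
degree at least $n$, it must be one. This turns a dimension bound into the absence of relations. -/
theorem algebraicIndependent_of_le_trdeg {n : ℕ} (w : Fin n → K)
    (hw : IntermediateField.adjoin ℂ (Set.range w) = ⊤) (hn : (n : Cardinal) ≤ Algebra.trdeg ℂ K) :
    AlgebraicIndependent ℂ w := by
  have := isAlgebraic_adjoin_of_eq_top hw
  exact (Algebra.IsAlgebraic.isTranscendenceBasis_of_lift_le_trdeg_of_finite ℂ w (by simpa using hn)).1

theorem trdeg_fractionRing_mvPolynomial (n : ℕ) :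
    (n : Cardinal) ≤ Algebra.trdeg ℂ (FractionRing (MvPolynomial (Fin n) ℂ)) := by
  have h : AlgebraicIndependent ℂ (fun i => algebraMap (MvPolynomial (Fin n) ℂ)
      (FractionRing (MvPolynomial (Fin n) ℂ)) (MvPolynomial.X i)) :=
    (MvPolynomial.algebraicIndependent_X (Fin n) ℂ).map' (f := IsScalarTower.toAlgHom ℂ
      (MvPolynomial (Fin n) ℂ) (FractionRing (MvPolynomial (Fin n) ℂ)))
      (IsFractionRing.injective _ _)
  simpa using h.cardinalMk_le_trdeg

theorem adjoin_fractionRing_eq_top {n : ℕ} {S : Set (FractionRing (MvPolynomial (Fin n) ℂ))}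
    (hS : ∀ i, algebraMap (MvPolynomial (Fin n) ℂ) _ (MvPolynomial.X i) ∈ S) :
    IntermediateField.adjoin ℂ S = ⊤ := by
  have hp (p : MvPolynomial (Fin n) ℂ) : algebraMap (MvPolynomial (Fin n) ℂ)
      (FractionRing (MvPolynomial (Fin n) ℂ)) p ∈ IntermediateField.adjoin ℂ S := by
    induction p using MvPolynomial.induction_on with
    | C c =>
      rw [← MvPolynomial.algebraMap_eq, ← IsScalarTower.algebraMap_apply]
      exact IntermediateField.algebraMap_mem _ c
    | add p q hp hq => rw [map_add]; exact add_mem hp hq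
    | mul_X p i hp =>
      rw [map_mul]
      exact mul_mem hp (IntermediateField.subset_adjoin ℂ _ (hS i))
  rw [eq_top_iff]
  rintro x -
  obtain ⟨p, q, -, rfl⟩ := IsFractionRing.div_surjective (A := MvPolynomial (Fin n) ℂ) x
  exact div_mem (hp p) (hp q)

end Fields

/-! ### The fibre of $\widehat\Upsilon$ over the origin. -/

namespace Upsilon

open MvPolynomial UpsilonBase UpsilonFibre

variable {R : Type} [CommRing R] [Algebra ℂ R] (v : UpsilonFibre → R)

theorem evalAt_zero_c (b : UpsilonBase) : evalAt 0 v (c b) = 0 := by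
  simp [c]

/-- The equations of the fibre of `Υ̂` over the origin. -/
theorem evalAt_zero_eq_zero (h33 : v p3 * v p3 = 0) (h13 : v y1 * v p3 = 0) (h23 : v y2 * v p3 = 0)
    (h1 : v x1 * v p3 + v y1 * v p1 = 0) (h2 : v x2 * v p3 + v y2 * v p1 = 0)
    (hu1 : v u * v p1 = 0) (hu2 : v u * v p2 = 0) (hu3 : v u * v p3 = 0) (hu4 : v u * v p4 = 0)
    (f : Poly) (hf : f ∈ Upsilon.ideal.toIdeal) : evalAt 0 v f = 0 := by
  have hle : Upsilon.ideal.toIdeal ≤ RingHom.ker (evalAt (0 : UpsilonBase → ℂ) v) := by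
    refine Ideal.span_le.2 ?_
    rintro f (((rfl | rfl) | rfl | rfl | rfl | rfl | rfl) | rfl | rfl)
    all_goals
      simp [pfaffian, matK, vecT, vecS, dotProduct, Matrix.mulVec, Fin.sum_univ_succ, A12, B11, B12,
        B22, evalAt_zero_c]
    all_goals
      first
      | linear_combination hu2
      | linear_combination hu4
      | linear_combination -h1
      | linear_combination -h2
      | linear_combination h13
      | linear_combination h23
      | linear_combination h33
      | linear_combination -h13
      | linear_combination -h23
      | linear_combination -h33
      | linear_combination hu1
      | linear_combination hu3
  exact hle hf

theorem p3_mul_p3_eq_zero (h : ∀ f ∈ Upsilon.ideal.toIdeal, evalAt 0 v f = 0) :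
    v p3 * v p3 = 0 := by
  -- Over the origin this Pfaffian reduces to $-p_3^2$.
  have := h (pfaffian 1 2 3 4) (Ideal.subset_span (by simp [equations]))
  simp [pfaffian, matK, A12, B11, B12, B22, evalAt_zero_c] at this
  linear_combination this

/-- A point of the `ℙ⁵` component of the fibre of `Υ̂` over the origin. -/
def bigPoint (w : Fin 5 → R) : UpsilonFibre → R
  | x1 => w 0
  | x2 => w 1
  | y1 => 1
  | y2 => w 2
  | p2 => w 3
  | p4 => w 4
  | p1 | p3 | u => 0

theorem hasPointOfDegree : HasPointOfDegree 5 (fibreAt Upsilon.ideal 0) := by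
  set K := FractionRing (MvPolynomial (Fin 5) ℂ)
  let w : Fin 5 → K := fun i => algebraMap (MvPolynomial (Fin 5) ℂ) K (X i)
  obtain ⟨g, hg⟩ := exists_hasCoord (I := Upsilon.ideal) (a := 0) y1 (bigPoint w) rfl
    (evalAt_zero_eq_zero (bigPoint w) (by simp [bigPoint]) (by simp [bigPoint]) (by simp [bigPoint])
      (by simp [bigPoint]) (by simp [bigPoint]) (by simp [bigPoint]) (by simp [bigPoint])
      (by simp [bigPoint]) (by simp [bigPoint]))
  refine ⟨K, _, _, g, trdeg_fractionRing_mvPolynomial 5,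
    hg.isMinimal (adjoin_fractionRing_eq_top fun i => ?_)⟩
  fin_cases i
  exacts [⟨x1, rfl⟩, ⟨x2, rfl⟩, ⟨y2, rfl⟩, ⟨p2, rfl⟩, ⟨p4, rfl⟩]

/-- A point of the fibre of `Υ̂` over the origin in the thickening of a `ℙ⁴` component. -/
def thickPoint (w : Fin 4 → R) (e : R) : UpsilonFibre → R
  | x1 => w 0
  | x2 => w 1
  | y1 => -(w 0 * e)
  | y2 => -(w 1 * e)
  | p1 => 1
  | p2 => w 2
  | p3 => e
  | p4 => w 3
  | u => 0

-- The generic point of the double component, thickened along $p_3$, has values in $K[[X]]/(X^2)$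
-- with $p_3=X$. A lift to the domain $K[[X]]$ would still satisfy $p_3^2=0$, hence $p_3=0$,
-- contradicting $X\ne0$ modulo $X^2$.
open PowerSeries in
theorem hasObstructedPointOfDegree :
    HasObstructedPointOfDegree 4 (fibreAt Upsilon.ideal 0) := by
  set K := FractionRing (MvPolynomial (Fin 4) ℂ)
  let J : Ideal K⟦X⟧ := Ideal.span {PowerSeries.X ^ 2}
  let ev : K⟦X⟧ →ₐ[ℂ] K :=
    { PowerSeries.constantCoeff (R := K) with
      commutes' := fun z => by
        simp [PowerSeries.algebraMap_apply] }
  have hev (z : K) : ev (PowerSeries.C z) = z := PowerSeries.constantCoeff_C z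
  let σ : (K⟦X⟧ ⧸ J) →ₐ[ℂ] K := Ideal.Quotient.liftₐ J ev (by
    intro f hf
    obtain ⟨q, rfl⟩ := Ideal.mem_span_singleton.1 hf
    change PowerSeries.constantCoeff (R := K) _ = 0
    simp)
  let π : K⟦X⟧ →ₐ[ℂ] (K⟦X⟧ ⧸ J) := Ideal.Quotient.mkₐ ℂ J
  have hπ : Function.Surjective π := Ideal.Quotient.mk_surjective
  have hσπ (f) : σ (π f) = ev f := rfl
  have hσ : Function.Surjective σ := fun z => ⟨π (PowerSeries.C z), by rw [hσπ, hev]⟩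
  have : Nontrivial (K⟦X⟧ ⧸ J) := hσ.nontrivial
  have : IsLocalRing (K⟦X⟧ ⧸ J) := IsLocalRing.of_surjective' (π : K⟦X⟧ →+* (K⟦X⟧ ⧸ J)) hπ
  have hσl : IsLocalHom (σ : (K⟦X⟧ ⧸ J) →+* K) := hσ.isLocalHom _
  have hπl : IsLocalHom (π : K⟦X⟧ →+* (K⟦X⟧ ⧸ J)) := hπ.isLocalHom _
  let w : Fin 4 → K := fun i => algebraMap (MvPolynomial (Fin 4) ℂ) K (MvPolynomial.X i)
  let e : K⟦X⟧ ⧸ J := π PowerSeries.X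
  have he : e * e = 0 := by
    rw [← map_mul, ← pow_two]
    exact Ideal.Quotient.eq_zero_iff_mem.2 (Ideal.subset_span rfl)
  -- These are the equations $y_ip_3=0$ for $y_i=-x_ip_3$.
  have hwe (z : K⟦X⟧ ⧸ J) : -(z * e) * e = 0 := by linear_combination -z * he
  obtain ⟨h, hh⟩ := exists_hasCoord (I := Upsilon.ideal) (a := 0) p1
    (thickPoint (fun i => π (PowerSeries.C (w i))) e) rfl
    (evalAt_zero_eq_zero _ he (hwe _) (hwe _)
      (by simp [thickPoint]) (by simp [thickPoint]) (by simp [thickPoint]) (by simp [thickPoint])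
      (by simp [thickPoint]) (by simp [thickPoint]))
  refine ⟨K, _, _, specOverMap σ ≫ h, trdeg_fractionRing_mvPolynomial 4,
    (hh.comp σ).isMinimal (adjoin_fractionRing_eq_top fun i => ?_), _, _, _, ‹_›, K⟦X⟧, _, _,
    inferInstance, π, σ, h, hπ, hσl, rfl, ?_⟩
  · have hw (i : Fin 4) : σ (π (PowerSeries.C (w i))) = w i := by rw [hσπ, hev]
    fin_cases i
    exacts [⟨x1, hw 0⟩, ⟨x2, hw 1⟩, ⟨p2, hw 2⟩, ⟨p4, hw 3⟩]
  · rintro ⟨h', rfl⟩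
    obtain ⟨w', hw', hv⟩ := hh.exists_lift
    have h3 : w' p3 = 0 := mul_self_eq_zero.1 (p3_mul_p3_eq_zero w' fun f hf => hw'.evalAt_eq_zero hf)
    have h0 : π PowerSeries.X = 0 := by
      have := congrFun hv p3
      rw [h3, map_zero] at this
      exact this.symm
    have h1 : (PowerSeries.X : K⟦X⟧) ^ 2 ∣ PowerSeries.X :=
      Ideal.mem_span_singleton.1 (Ideal.Quotient.eq_zero_iff_mem.1 h0)
    have := PowerSeries.X_pow_dvd_iff.1 h1 1 (by norm_num)
    simp at this

end Upsilon

theorem eval_eq_zero_of_algebraicIndependent {K : Type} [Field K] [Algebra ℂ K] {n : ℕ}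
    {w : Fin n → K} (hw : AlgebraicIndependent ℂ w) {f : MvPolynomial (Fin n) ℂ}
    (hf : MvPolynomial.aeval w f = 0) (x : Fin n → ℂ) : MvPolynomial.eval x f = 0 := by
  rw [hw.eq_zero_of_aeval_eq_zero f hf, map_zero]

/-! ### The equations of the fibres of $\widehat\Sigma$. -/

namespace Sigma

open MvPolynomial SigmaBase SigmaFibre

variable {R : Type} [CommRing R] [Algebra ℂ R] (a : SigmaBase → ℂ) (v : SigmaFibre → R)

theorem evalAt_c (b : SigmaBase) : evalAt a v (c b) = algebraMap ℂ R (a b) := by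
  simp [c]

/-- The vector `S p + p₄ t`. -/
noncomputable def vecW (a : SigmaBase → ℂ) (v : SigmaFibre → R) : Fin 3 → R :=
  ![algebraMap ℂ R (a s11) * v p1 + algebraMap ℂ R (a s12) * v p2 + algebraMap ℂ R (a s13) * v p3 +
      v p4 * algebraMap ℂ R (a t1),
    algebraMap ℂ R (a s12) * v p1 + algebraMap ℂ R (a s22) * v p2 + algebraMap ℂ R (a s23) * v p3 +
      v p4 * algebraMap ℂ R (a t2),
    algebraMap ℂ R (a s13) * v p1 + algebraMap ℂ R (a s23) * v p2 + algebraMap ℂ R (a s33) * v p3 +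
      v p4 * algebraMap ℂ R (a t3)]

/-- The vector `A t`. -/
noncomputable def vecN (a : SigmaBase → ℂ) (v : SigmaFibre → R) : Fin 3 → R :=
  ![v q2 * algebraMap ℂ R (a t3) - v q3 * algebraMap ℂ R (a t2),
    v q3 * algebraMap ℂ R (a t1) - v q1 * algebraMap ℂ R (a t3),
    v q1 * algebraMap ℂ R (a t2) - v q2 * algebraMap ℂ R (a t1)]

/-- The vector `S A t`. -/
noncomputable def vecM (a : SigmaBase → ℂ) (v : SigmaFibre → R) : Fin 3 → R :=
  ![algebraMap ℂ R (a s11) * vecN a v 0 + algebraMap ℂ R (a s12) * vecN a v 1 +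
      algebraMap ℂ R (a s13) * vecN a v 2,
    algebraMap ℂ R (a s12) * vecN a v 0 + algebraMap ℂ R (a s22) * vecN a v 1 +
      algebraMap ℂ R (a s23) * vecN a v 2,
    algebraMap ℂ R (a s13) * vecN a v 0 + algebraMap ℂ R (a s23) * vecN a v 1 +
      algebraMap ℂ R (a s33) * vecN a v 2]

section Equations

variable {a v} (h : ∀ f ∈ Sigma.ideal.toIdeal, evalAt a v f = 0)

include h

theorem pq_eq : v p1 * v q1 + v p2 * v q2 + v p3 * v q3 = 0 := by
  have := h _ (Ideal.subset_span (Or.inl (Or.inl (Or.inl rfl))))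
  simp [dotProduct, Fin.sum_univ_three, vecP, vecQ] at this
  linear_combination this

theorem pSp_eq : algebraMap ℂ R (a s11) * v p1 ^ 2 + 2 * algebraMap ℂ R (a s12) * v p1 * v p2 +
    2 * algebraMap ℂ R (a s13) * v p1 * v p3 + algebraMap ℂ R (a s22) * v p2 ^ 2 +
    2 * algebraMap ℂ R (a s23) * v p2 * v p3 + algebraMap ℂ R (a s33) * v p3 ^ 2 +
    v p4 * (algebraMap ℂ R (a t1) * v p1 + algebraMap ℂ R (a t2) * v p2 +
      algebraMap ℂ R (a t3) * v p3) = 0 := by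
  have := h _ (Ideal.subset_span (Or.inl (Or.inl (Or.inr (Or.inl rfl)))))
  simp [dotProduct, Matrix.mulVec, Fin.sum_univ_three, vecP, vecT, matS, evalAt_c] at this
  linear_combination this

theorem up4_eq : v u * v p4 + v r ^ 2 +
    (algebraMap ℂ R (a s22 * a s33 - a s23 ^ 2) * v q1 ^ 2 +
      algebraMap ℂ R (a s11 * a s33 - a s13 ^ 2) * v q2 ^ 2 +
      algebraMap ℂ R (a s11 * a s22 - a s12 ^ 2) * v q3 ^ 2 +
      2 * algebraMap ℂ R (a s13 * a s23 - a s12 * a s33) * v q1 * v q2 +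
      2 * algebraMap ℂ R (a s12 * a s23 - a s13 * a s22) * v q1 * v q3 +
      2 * algebraMap ℂ R (a s12 * a s13 - a s11 * a s23) * v q2 * v q3) = 0 := by
  have := h _ (Ideal.subset_span (Or.inl (Or.inl (Or.inr (Or.inr rfl)))))
  simp [dotProduct, Matrix.mulVec, Fin.sum_univ_three, vecQ, matS, evalAt_c,
    Matrix.adjugate_fin_three] at this
  simp only [map_sub, map_mul, map_pow]
  linear_combination this

theorem rp_eq (i : Fin 3) : evalAt a v ((((X r : Poly) • (1 : Matrix (Fin 3) (Fin 3) Poly) +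
    matA * matS).mulVec vecP + (X p4 : Poly) • (matA.mulVec vecT)) i) = 0 :=
  h _ (Ideal.subset_span (Or.inl (Or.inr ⟨i, rfl⟩)))

theorem up_eq (i : Fin 3) : evalAt a v (((X u : Poly) • vecP -
    ((X r : Poly) • (1 : Matrix (Fin 3) (Fin 3) Poly) - matA * matS).mulVec
      (matA.mulVec vecT)) i) = 0 :=
  h _ (Ideal.subset_span (Or.inr ⟨i, rfl⟩))

/-- Since $Aw=q\times w$, the two vector equations read $rp=-q\times(Sp+p_4t)$ and
$up=rAt-q\times(SAt)$. This lemma and the five after it are their components; where $p_i=1$ they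
express $r$ and $u$ through the other coordinates. -/
theorem rp1_eq : v r * v p1 = v q3 * vecW a v 1 - v q2 * vecW a v 2 := by
  have := rp_eq h 0
  simp [dotProduct, Matrix.mulVec, Fin.sum_univ_three, vecP, vecT, matS, matA, evalAt_c] at this
  simp [vecW]
  linear_combination this

theorem up1_eq : v u * v p1 = v r * vecN a v 0 -
    (v q2 * vecM a v 2 - v q3 * vecM a v 1) := by
  have := up_eq h 0
  simp [dotProduct, Matrix.mulVec, Fin.sum_univ_three, vecP, vecT, matS, matA, evalAt_c] at this
  simp [vecN, vecM]
  linear_combination this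

theorem rp2_eq : v r * v p2 = v q1 * vecW a v 2 - v q3 * vecW a v 0 := by
  have := rp_eq h 1
  simp [dotProduct, Matrix.mulVec, Fin.sum_univ_three, vecP, vecT, matS, matA, evalAt_c] at this
  simp [vecW]
  linear_combination this

theorem up2_eq : v u * v p2 = v r * vecN a v 1 -
    (v q3 * vecM a v 0 - v q1 * vecM a v 2) := by
  have := up_eq h 1
  simp [dotProduct, Matrix.mulVec, Fin.sum_univ_three, vecP, vecT, matS, matA, evalAt_c] at this
  simp [vecN, vecM]
  linear_combination this

theorem rp3_eq : v r * v p3 = v q2 * vecW a v 0 - v q1 * vecW a v 1 := by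
  have := rp_eq h 2
  simp [dotProduct, Matrix.mulVec, Fin.sum_univ_three, vecP, vecT, matS, matA, evalAt_c] at this
  simp [vecW]
  linear_combination this

theorem up3_eq : v u * v p3 = v r * vecN a v 2 -
    (v q1 * vecM a v 1 - v q2 * vecM a v 0) := by
  have := up_eq h 2
  simp [dotProduct, Matrix.mulVec, Fin.sum_univ_three, vecP, vecT, matS, matA, evalAt_c] at this
  simp [vecN, vecM]
  linear_combination this

end Equations

end Sigma

namespace Sigma

open MvPolynomial SigmaBase SigmaFibre

/-- The equations of the fibre of `Σ̂` over the origin. -/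
theorem evalAt_zero_eq_zero {R : Type} [CommRing R] [Algebra ℂ R] (v : SigmaFibre → R)
    (hpq : v p1 * v q1 + v p2 * v q2 + v p3 * v q3 = 0)
    (hr1 : v r * v p1 = 0) (hr2 : v r * v p2 = 0) (hr3 : v r * v p3 = 0)
    (hu1 : v u * v p1 = 0) (hu2 : v u * v p2 = 0) (hu3 : v u * v p3 = 0)
    (hu4 : v u * v p4 + v r ^ 2 = 0)
    (f : Poly) (hf : f ∈ Sigma.ideal.toIdeal) : evalAt 0 v f = 0 := by
  have hc (b : SigmaBase) : evalAt 0 v (c b) = 0 := by simp [c]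
  have hle : Sigma.ideal.toIdeal ≤ RingHom.ker (evalAt (0 : SigmaBase → ℂ) v) := by
    refine Ideal.span_le.2 ?_
    rintro f (((rfl | rfl | rfl) | ⟨i, rfl⟩) | ⟨i, rfl⟩)
    · simp [dotProduct, Fin.sum_univ_three, vecP, vecQ]
      linear_combination hpq
    · simp [dotProduct, Matrix.mulVec, Fin.sum_univ_three, vecP, vecT, matS, hc]
    · simp [dotProduct, Matrix.mulVec, Fin.sum_univ_three, vecQ, matS, hc,
        Matrix.adjugate_fin_three]
      linear_combination hu4
    · fin_cases i <;>
        simp [dotProduct, Matrix.mulVec, Fin.sum_univ_three, vecP, vecT, matS, matA, hc, hr1, hr2,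
          hr3]
    · fin_cases i <;>
        simp [dotProduct, Matrix.mulVec, Fin.sum_univ_three, vecP, vecT, matS, matA, hc, hu1, hu2,
          hu3]
  exact hle hf

/-! ### Fibres of $\widehat\Sigma$ over nonzero points. -/

section Field

variable {K : Type} [Field K] [Algebra ℂ K]

/-- A nontrivial relation among the coordinates on a chart `pᵢ ≠ 0`. -/
theorem coeff_eq_zero_of_relation {w : Fin 5 → K} (hw : AlgebraicIndependent ℂ w)
    {a0 a1 a2 a3 a4 a5 b0 b1 b2 : ℂ}
    (h : algebraMap ℂ K a0 + 2 * algebraMap ℂ K a1 * w 0 + 2 * algebraMap ℂ K a2 * w 1 +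
      algebraMap ℂ K a3 * w 0 ^ 2 + 2 * algebraMap ℂ K a4 * w 0 * w 1 + algebraMap ℂ K a5 * w 1 ^ 2 +
      w 2 * (algebraMap ℂ K b0 + algebraMap ℂ K b1 * w 0 + algebraMap ℂ K b2 * w 1) = 0) :
    a0 = 0 ∧ a1 = 0 ∧ a2 = 0 ∧ a3 = 0 ∧ a4 = 0 ∧ a5 = 0 ∧ b0 = 0 ∧ b1 = 0 ∧ b2 = 0 := by
  -- Independence makes the relation a polynomial identity, so it holds for all complex values; nine
  -- substitutions isolate the nine coefficients.
  have key (x y z : ℂ) : a0 + 2 * a1 * x + 2 * a2 * y + a3 * x ^ 2 + 2 * a4 * x * y + a5 * y ^ 2 +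
      z * (b0 + b1 * x + b2 * y) = 0 := by
    have := eval_eq_zero_of_algebraicIndependent hw (f := C a0 + 2 * C a1 * X 0 + 2 * C a2 * X 1 +
      C a3 * X 0 ^ 2 + 2 * C a4 * X 0 * X 1 + C a5 * X 1 ^ 2 +
      X 2 * (C b0 + C b1 * X 0 + C b2 * X 1))
      (by simpa [MvPolynomial.aeval_C] using h) ![x, y, z, 0, 0]
    simp at this
    linear_combination this
  have h000 := key 0 0 0
  have h001 := key 0 0 1
  have h100 := key 1 0 0
  have h200 := key (-1) 0 0
  have h010 := key 0 1 0
  have h020 := key 0 (-1) 0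
  have h110 := key 1 1 0
  have h101 := key 1 0 1
  have h011 := key 0 1 1
  refine ⟨?_, ?_, ?_, ?_, ?_, ?_, ?_, ?_, ?_⟩
  · linear_combination h000
  · linear_combination (h100 - h200) / 4
  · linear_combination (h010 - h020) / 4
  · linear_combination (h100 + h200) / 2 - h000
  · linear_combination (h110 - h100 - h010 + h000) / 2
  · linear_combination (h010 + h020) / 2 - h000
  · linear_combination h001 - h000
  · linear_combination h101 - h100 - h001 + h000
  · linear_combination h011 - h010 - h001 + h000

variable {a : SigmaBase → ℂ} {v : SigmaFibre → K}

theorem vecW_mem (L : IntermediateField ℂ K) (h1 : v p1 ∈ L) (h2 : v p2 ∈ L) (h3 : v p3 ∈ L)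
    (h4 : v p4 ∈ L) (i : Fin 3) : vecW a v i ∈ L := by
  have hA (b : SigmaBase) : algebraMap ℂ K (a b) ∈ L := L.algebraMap_mem _
  fin_cases i <;> simp only [vecW] <;>
    exact add_mem (add_mem (add_mem (mul_mem (hA _) h1) (mul_mem (hA _) h2)) (mul_mem (hA _) h3))
      (mul_mem h4 (hA _))

theorem vecN_mem (L : IntermediateField ℂ K) (h1 : v q1 ∈ L) (h2 : v q2 ∈ L) (h3 : v q3 ∈ L)
    (i : Fin 3) : vecN a v i ∈ L := by
  have hA (b : SigmaBase) : algebraMap ℂ K (a b) ∈ L := L.algebraMap_mem _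
  fin_cases i <;> simp only [vecN]
  · exact sub_mem (mul_mem h2 (hA _)) (mul_mem h3 (hA _))
  · exact sub_mem (mul_mem h3 (hA _)) (mul_mem h1 (hA _))
  · exact sub_mem (mul_mem h1 (hA _)) (mul_mem h2 (hA _))

theorem vecM_mem (L : IntermediateField ℂ K) (h1 : v q1 ∈ L) (h2 : v q2 ∈ L) (h3 : v q3 ∈ L)
    (i : Fin 3) : vecM a v i ∈ L := by
  have hA (b : SigmaBase) : algebraMap ℂ K (a b) ∈ L := L.algebraMap_mem _
  have hN := vecN_mem (a := a) L h1 h2 h3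
  fin_cases i <;> simp only [vecM] <;>
    exact add_mem (add_mem (mul_mem (hA _) (hN _)) (mul_mem (hA _) (hN _))) (mul_mem (hA _) (hN _))

theorem adjoin_eq_top_of_mem {n : ℕ} (w : Fin n → K)
    (hv : IntermediateField.adjoin ℂ (Set.range v) = ⊤)
    (h : ∀ j, v j ∈ IntermediateField.adjoin ℂ (Set.range w)) :
    IntermediateField.adjoin ℂ (Set.range w) = ⊤ := by
  rw [eq_top_iff, ← hv, IntermediateField.adjoin_le_iff]
  rintro _ ⟨j, rfl⟩
  exact h j

variable (hv : IntermediateField.adjoin ℂ (Set.range v) = ⊤)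
  (hI : ∀ f ∈ Sigma.ideal.toIdeal, evalAt a v f = 0) (hK : (5 : Cardinal) ≤ Algebra.trdeg ℂ K)

include hv hI hK

/-- With $p_1=1$, the equation ${}^tpq=0$ eliminates $q_1$, and the two vector equations eliminate
$r$ and then $u$. The five remaining coordinates are therefore independent, so the relation
${}^tpSp+p_4\,{}^tpt=0$ must be trivial; its coefficients are, up to factors 2, the coordinates of
$a$. The charts of $p_2$ and $p_3$ follow by cyclic permutation of the indices. -/
theorem base_eq_zero_of_p1 (h1 : v p1 = 1) : a = 0 := by
  set L := IntermediateField.adjoin ℂ (Set.range ![v p2, v p3, v p4, v q2, v q3]) with hL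
  have hw (l : Fin 5) : ![v p2, v p3, v p4, v q2, v q3] l ∈ L :=
    IntermediateField.subset_adjoin ℂ _ ⟨l, rfl⟩
  have hp1 : v p1 ∈ L := h1 ▸ one_mem L
  have hp2 : v p2 ∈ L := hw 0
  have hp3 : v p3 ∈ L := hw 1
  have hp4 : v p4 ∈ L := hw 2
  have hq2 : v q2 ∈ L := hw 3
  have hq3 : v q3 ∈ L := hw 4
  have hq1 : v q1 ∈ L := by
    rw [show v q1 = -(v p2 * v q2 + v p3 * v q3) by
      linear_combination pq_eq hI - v q1 * h1]
    exact neg_mem (add_mem (mul_mem hp2 hq2) (mul_mem hp3 hq3))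
  have hW := vecW_mem (a := a) L hp1 hp2 hp3 hp4
  have hN := vecN_mem (a := a) L hq1 hq2 hq3
  have hM := vecM_mem (a := a) L hq1 hq2 hq3
  have hr : v r ∈ L := by
    have := rp1_eq hI
    rw [h1, mul_one] at this
    rw [this]
    exact sub_mem (mul_mem hq3 (hW _)) (mul_mem hq2 (hW _))
  have hu : v u ∈ L := by
    have := up1_eq hI
    rw [h1, mul_one] at this
    rw [this]
    exact sub_mem (mul_mem hr (hN _)) (sub_mem (mul_mem hq2 (hM _)) (mul_mem hq3 (hM _)))
  have hind := algebraicIndependent_of_le_trdeg _ (adjoin_eq_top_of_mem _ hv (by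
    intro l
    cases l <;> assumption)) hK
  obtain ⟨e0, e1, e2, e3, e4, e5, e6, e7, e8⟩ := coeff_eq_zero_of_relation hind
    (a0 := a s11) (a1 := a s12) (a2 := a s13) (a3 := a s22) (a4 := a s23) (a5 := a s33)
    (b0 := a t1) (b1 := a t2) (b2 := a t3) (by
      have := pSp_eq hI
      rw [h1] at this
      simp
      linear_combination this)
  funext l
  cases l <;> assumption

theorem base_eq_zero_of_p2 (h2 : v p2 = 1) : a = 0 := by
  set L := IntermediateField.adjoin ℂ (Set.range ![v p3, v p1, v p4, v q3, v q1]) with hL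
  have hw (l : Fin 5) : ![v p3, v p1, v p4, v q3, v q1] l ∈ L :=
    IntermediateField.subset_adjoin ℂ _ ⟨l, rfl⟩
  have hp2 : v p2 ∈ L := h2 ▸ one_mem L
  have hp3 : v p3 ∈ L := hw 0
  have hp1 : v p1 ∈ L := hw 1
  have hp4 : v p4 ∈ L := hw 2
  have hq3 : v q3 ∈ L := hw 3
  have hq1 : v q1 ∈ L := hw 4
  have hq2 : v q2 ∈ L := by
    rw [show v q2 = -(v p3 * v q3 + v p1 * v q1) by
      linear_combination pq_eq hI - v q2 * h2]
    exact neg_mem (add_mem (mul_mem hp3 hq3) (mul_mem hp1 hq1))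
  have hW := vecW_mem (a := a) L hp1 hp2 hp3 hp4
  have hN := vecN_mem (a := a) L hq1 hq2 hq3
  have hM := vecM_mem (a := a) L hq1 hq2 hq3
  have hr : v r ∈ L := by
    have := rp2_eq hI
    rw [h2, mul_one] at this
    rw [this]
    exact sub_mem (mul_mem hq1 (hW _)) (mul_mem hq3 (hW _))
  have hu : v u ∈ L := by
    have := up2_eq hI
    rw [h2, mul_one] at this
    rw [this]
    exact sub_mem (mul_mem hr (hN _)) (sub_mem (mul_mem hq3 (hM _)) (mul_mem hq1 (hM _)))
  have hind := algebraicIndependent_of_le_trdeg _ (adjoin_eq_top_of_mem _ hv (by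
    intro l
    cases l <;> assumption)) hK
  obtain ⟨e0, e1, e2, e3, e4, e5, e6, e7, e8⟩ := coeff_eq_zero_of_relation hind
    (a0 := a s22) (a1 := a s23) (a2 := a s12) (a3 := a s33) (a4 := a s13) (a5 := a s11)
    (b0 := a t2) (b1 := a t3) (b2 := a t1) (by
      have := pSp_eq hI
      rw [h2] at this
      simp
      linear_combination this)
  funext l
  cases l <;> assumption

theorem base_eq_zero_of_p3 (h3 : v p3 = 1) : a = 0 := by
  set L := IntermediateField.adjoin ℂ (Set.range ![v p1, v p2, v p4, v q1, v q2]) with hL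
  have hw (l : Fin 5) : ![v p1, v p2, v p4, v q1, v q2] l ∈ L :=
    IntermediateField.subset_adjoin ℂ _ ⟨l, rfl⟩
  have hp3 : v p3 ∈ L := h3 ▸ one_mem L
  have hp1 : v p1 ∈ L := hw 0
  have hp2 : v p2 ∈ L := hw 1
  have hp4 : v p4 ∈ L := hw 2
  have hq1 : v q1 ∈ L := hw 3
  have hq2 : v q2 ∈ L := hw 4
  have hq3 : v q3 ∈ L := by
    rw [show v q3 = -(v p1 * v q1 + v p2 * v q2) by
      linear_combination pq_eq hI - v q3 * h3]
    exact neg_mem (add_mem (mul_mem hp1 hq1) (mul_mem hp2 hq2))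
  have hW := vecW_mem (a := a) L hp1 hp2 hp3 hp4
  have hN := vecN_mem (a := a) L hq1 hq2 hq3
  have hM := vecM_mem (a := a) L hq1 hq2 hq3
  have hr : v r ∈ L := by
    have := rp3_eq hI
    rw [h3, mul_one] at this
    rw [this]
    exact sub_mem (mul_mem hq2 (hW _)) (mul_mem hq1 (hW _))
  have hu : v u ∈ L := by
    have := up3_eq hI
    rw [h3, mul_one] at this
    rw [this]
    exact sub_mem (mul_mem hr (hN _)) (sub_mem (mul_mem hq1 (hM _)) (mul_mem hq2 (hM _)))
  have hind := algebraicIndependent_of_le_trdeg _ (adjoin_eq_top_of_mem _ hv (by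
    intro l
    cases l <;> assumption)) hK
  obtain ⟨e0, e1, e2, e3, e4, e5, e6, e7, e8⟩ := coeff_eq_zero_of_relation hind
    (a0 := a s33) (a1 := a s13) (a2 := a s23) (a3 := a s11) (a4 := a s12) (a5 := a s22)
    (b0 := a t3) (b1 := a t1) (b2 := a t2) (by
      have := pSp_eq hI
      rw [h3] at this
      simp
      linear_combination this)
  funext l
  cases l <;> assumption

/-- Six coordinates remain, one of them equal to 1, so the other five would be independent. But
$up_4+r^2+{}^tqS^\dagger q=0$ is a nontrivial relation for every $S$, because of the terms $up_4$
and $r^2$. -/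
theorem false_of_p_eq_zero (h1 : v p1 = 0) (h2 : v p2 = 0) (h3 : v p3 = 0) {i : SigmaFibre}
    (hi : v i = 1) : False := by
  -- The entries of $S^\dagger$ become opaque constants: their values play no role.
  obtain ⟨e11, he11⟩ : ∃ e, e = a s22 * a s33 - a s23 ^ 2 := ⟨_, rfl⟩
  obtain ⟨e22, he22⟩ : ∃ e, e = a s11 * a s33 - a s13 ^ 2 := ⟨_, rfl⟩
  obtain ⟨e33, he33⟩ : ∃ e, e = a s11 * a s22 - a s12 ^ 2 := ⟨_, rfl⟩
  obtain ⟨e12, he12⟩ : ∃ e, e = a s13 * a s23 - a s12 * a s33 := ⟨_, rfl⟩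
  obtain ⟨e13, he13⟩ : ∃ e, e = a s12 * a s23 - a s13 * a s22 := ⟨_, rfl⟩
  obtain ⟨e23, he23⟩ : ∃ e, e = a s12 * a s13 - a s11 * a s23 := ⟨_, rfl⟩
  have hrel := up4_eq hI
  rw [← he11, ← he22, ← he33, ← he12, ← he13, ← he23] at hrel
  have hind (w : Fin 5 → K) (h : ∀ j, j = i ∨ j = p1 ∨ j = p2 ∨ j = p3 ∨ v j ∈ Set.range w) :
      AlgebraicIndependent ℂ w := by
    refine algebraicIndependent_of_le_trdeg w (adjoin_eq_top_of_mem w hv fun j => ?_) hK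
    rcases h j with rfl | rfl | rfl | rfl | hj
    · rw [hi]; exact one_mem _
    · rw [h1]; exact zero_mem _
    · rw [h2]; exact zero_mem _
    · rw [h3]; exact zero_mem _
    · exact IntermediateField.subset_adjoin ℂ _ hj
  cases i
  · simp [h1] at hi
  · simp [h2] at hi
  · simp [h3] at hi
  · have hf := eval_eq_zero_of_algebraicIndependent
      (hind ![v q1, v q2, v q3, v r, v u] (by rintro (_ | _) <;> simp))
      (f := X 4 * 1 + X 3 ^ 2 + (C e11 * X 0 ^ 2 + C e22 * X 1 ^ 2 +
      C e33 * X 2 ^ 2 + 2 * C e12 * X 0 * X 1 + 2 * C e13 * X 0 * X 2 +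
      2 * C e23 * X 1 * X 2))
      (by simp; rw [hi] at hrel; linear_combination hrel)
    -- In each case the relation is evaluated at the origin and at a point where $up_4=1$ and the
    -- other free coordinates vanish; the values cannot both be zero. For $i=r$ the origin alone
    -- suffices, the value there being 1.
    have hx := hf ![0, 0, 0, 0, 1]
    have h0 := hf 0
    simp at hx h0
  · have hf := eval_eq_zero_of_algebraicIndependent
      (hind ![v p4, v q2, v q3, v r, v u] (by rintro (_ | _) <;> simp))
      (f := X 4 * X 0 + X 3 ^ 2 + (C e11 * 1 ^ 2 + C e22 * X 1 ^ 2 +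
      C e33 * X 2 ^ 2 + 2 * C e12 * 1 * X 1 + 2 * C e13 * 1 * X 2 +
      2 * C e23 * X 1 * X 2))
      (by simp; rw [hi] at hrel; linear_combination hrel)
    have hx := hf ![1, 0, 0, 0, 1]
    have h0 := hf 0
    simp at hx h0
    rw [h0] at hx
    simp at hx
  · have hf := eval_eq_zero_of_algebraicIndependent
      (hind ![v p4, v q1, v q3, v r, v u] (by rintro (_ | _) <;> simp))
      (f := X 4 * X 0 + X 3 ^ 2 + (C e11 * X 1 ^ 2 + C e22 * 1 ^ 2 +
      C e33 * X 2 ^ 2 + 2 * C e12 * X 1 * 1 + 2 * C e13 * X 1 * X 2 +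
      2 * C e23 * 1 * X 2))
      (by simp; rw [hi] at hrel; linear_combination hrel)
    have hx := hf ![1, 0, 0, 0, 1]
    have h0 := hf 0
    simp at hx h0
    rw [h0] at hx
    simp at hx
  · have hf := eval_eq_zero_of_algebraicIndependent
      (hind ![v p4, v q1, v q2, v r, v u] (by rintro (_ | _) <;> simp))
      (f := X 4 * X 0 + X 3 ^ 2 + (C e11 * X 1 ^ 2 + C e22 * X 2 ^ 2 +
      C e33 * 1 ^ 2 + 2 * C e12 * X 1 * X 2 + 2 * C e13 * X 1 * 1 +
      2 * C e23 * X 2 * 1))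
      (by simp; rw [hi] at hrel; linear_combination hrel)
    have hx := hf ![1, 0, 0, 0, 1]
    have h0 := hf 0
    simp at hx h0
    rw [h0] at hx
    simp at hx
  · have hf := eval_eq_zero_of_algebraicIndependent
      (hind ![v p4, v q1, v q2, v q3, v u] (by rintro (_ | _) <;> simp))
      (f := X 4 * X 0 + 1 ^ 2 + (C e11 * X 1 ^ 2 + C e22 * X 2 ^ 2 +
      C e33 * X 3 ^ 2 + 2 * C e12 * X 1 * X 2 + 2 * C e13 * X 1 * X 3 +
      2 * C e23 * X 2 * X 3))
      (by simp; rw [hi] at hrel; linear_combination hrel)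
    have hx := hf ![0, 0, 0, 0, 0]
    have h0 := hf 0
    simp at hx h0
  · have hf := eval_eq_zero_of_algebraicIndependent
      (hind ![v p4, v q1, v q2, v q3, v r] (by rintro (_ | _) <;> simp))
      (f := 1 * X 0 + X 4 ^ 2 + (C e11 * X 1 ^ 2 + C e22 * X 2 ^ 2 +
      C e33 * X 3 ^ 2 + 2 * C e12 * X 1 * X 2 + 2 * C e13 * X 1 * X 3 +
      2 * C e23 * X 2 * X 3))
      (by simp; rw [hi] at hrel; linear_combination hrel)
    have hx := hf ![1, 0, 0, 0, 0]
    have h0 := hf 0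
    simp at hx h0

end Field

theorem not_hasPointOfDegree {a : SigmaBase → ℂ} (ha : a ≠ 0) :
    ¬ HasPointOfDegree 5 (fibreAt Sigma.ideal a) := by
  rintro ⟨K, _, _, g, hK, hg⟩
  by_cases h : InChart g p1 ∨ InChart g p2 ∨ InChart g p3
  · rcases h with h | h | h <;> obtain ⟨v, hv⟩ := h.exists_hasCoord
    · exact ha (base_eq_zero_of_p1 (hv.adjoin_eq_top hg) (fun f hf => hv.evalAt_eq_zero hf) hK
        hv.apply_self)
    · exact ha (base_eq_zero_of_p2 (hv.adjoin_eq_top hg) (fun f hf => hv.evalAt_eq_zero hf) hK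
        hv.apply_self)
    · exact ha (base_eq_zero_of_p3 (hv.adjoin_eq_top hg) (fun f hf => hv.evalAt_eq_zero hf) hK
        hv.apply_self)
  · obtain ⟨i, hi⟩ := exists_inChart g
    obtain ⟨v, hv⟩ := hi.exists_hasCoord
    simp only [hv.inChart_iff, isUnit_iff_ne_zero, not_or, not_not] at h
    exact false_of_p_eq_zero (hv.adjoin_eq_top hg) (fun f hf => hv.evalAt_eq_zero hf) hK
      h.1 h.2.1 h.2.2 hv.apply_self

end Sigma

/-! ### Lifting of points in the fibre of $\widehat\Sigma$ over the origin. -/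

namespace Sigma

open MvPolynomial SigmaBase SigmaFibre

section Lift

variable {R R' : Type} [CommRing R] [Algebra ℂ R] [CommRing R'] [Algebra ℂ R'] {π : R' →ₐ[ℂ] R}
  (hπ : Function.Surjective π) {h : specOver R ⟶ fibreAt Sigma.ideal 0} {v : SigmaFibre → R}

include hπ

/-- Over the origin, $p_1=1$ forces $r=u=0$ and $q_1=-(p_2q_2+p_3q_3)$. The chart is an affine space
in the other coordinates, whose values may be lifted arbitrarily. -/
theorem exists_lift_p1 (hv : HasCoord h p1 v) :
    ∃ h' : specOver R' ⟶ fibreAt Sigma.ideal 0, specOverMap π ≫ h' = h := by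
  have hI := fun f hf => hv.evalAt_eq_zero (f := f) hf
  have h1 := hv.apply_self
  have hr : v r = 0 := by simpa [h1, vecW] using rp1_eq hI
  have hu : v u = 0 := by simpa [h1, vecM, vecN, hr] using up1_eq hI
  have hq : v q1 = -(v p2 * v q2 + v p3 * v q3) := by
    linear_combination pq_eq hI - v q1 * h1
  -- A set-theoretic section is enough, since the free coordinates satisfy no equation.
  choose s hs using hπ
  let w : SigmaFibre → R' := fun
    | p1 => 1
    | p2 => s (v p2)
    | p3 => s (v p3)
    | p4 => s (v p4)
    | q1 => -(s (v p2) * s (v q2) + s (v p3) * s (v q3))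
    | q2 => s (v q2)
    | q3 => s (v q3)
    | r => 0
    | u => 0
  obtain ⟨h', hh'⟩ := exists_hasCoord (I := Sigma.ideal) (a := 0) p1 w rfl
    (evalAt_zero_eq_zero w (by simp only [w]; ring) (by simp [w]) (by simp [w]) (by simp [w])
      (by simp [w]) (by simp [w]) (by simp [w]) (by simp [w]))
  refine ⟨h', (hh'.comp π).point_eq ?_⟩
  convert hv using 2 with l
  cases l <;> simp [w, hs, h1, hr, hu, hq]

theorem exists_lift_p2 (hv : HasCoord h p2 v) :
    ∃ h' : specOver R' ⟶ fibreAt Sigma.ideal 0, specOverMap π ≫ h' = h := by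
  have hI := fun f hf => hv.evalAt_eq_zero (f := f) hf
  have h1 := hv.apply_self
  have hr : v r = 0 := by simpa [h1, vecW] using rp2_eq hI
  have hu : v u = 0 := by simpa [h1, vecM, vecN, hr] using up2_eq hI
  have hq : v q2 = -(v p3 * v q3 + v p1 * v q1) := by
    linear_combination pq_eq hI - v q2 * h1
  choose s hs using hπ
  let w : SigmaFibre → R' := fun
    | p1 => s (v p1)
    | p2 => 1
    | p3 => s (v p3)
    | p4 => s (v p4)
    | q1 => s (v q1)
    | q2 => -(s (v p3) * s (v q3) + s (v p1) * s (v q1))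
    | q3 => s (v q3)
    | r => 0
    | u => 0
  obtain ⟨h', hh'⟩ := exists_hasCoord (I := Sigma.ideal) (a := 0) p2 w rfl
    (evalAt_zero_eq_zero w (by simp only [w]; ring) (by simp [w]) (by simp [w]) (by simp [w])
      (by simp [w]) (by simp [w]) (by simp [w]) (by simp [w]))
  refine ⟨h', (hh'.comp π).point_eq ?_⟩
  convert hv using 2 with l
  cases l <;> simp [w, hs, h1, hr, hu, hq]

theorem exists_lift_p3 (hv : HasCoord h p3 v) :
    ∃ h' : specOver R' ⟶ fibreAt Sigma.ideal 0, specOverMap π ≫ h' = h := by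
  have hI := fun f hf => hv.evalAt_eq_zero (f := f) hf
  have h1 := hv.apply_self
  have hr : v r = 0 := by simpa [h1, vecW] using rp3_eq hI
  have hu : v u = 0 := by simpa [h1, vecM, vecN, hr] using up3_eq hI
  have hq : v q3 = -(v p1 * v q1 + v p2 * v q2) := by
    linear_combination pq_eq hI - v q3 * h1
  choose s hs using hπ
  let w : SigmaFibre → R' := fun
    | p1 => s (v p1)
    | p2 => s (v p2)
    | p3 => 1
    | p4 => s (v p4)
    | q1 => s (v q1)
    | q2 => s (v q2)
    | q3 => -(s (v p1) * s (v q1) + s (v p2) * s (v q2))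
    | r => 0
    | u => 0
  obtain ⟨h', hh'⟩ := exists_hasCoord (I := Sigma.ideal) (a := 0) p3 w rfl
    (evalAt_zero_eq_zero w (by simp only [w]; ring) (by simp [w]) (by simp [w]) (by simp [w])
      (by simp [w]) (by simp [w]) (by simp [w]) (by simp [w]))
  refine ⟨h', (hh'.comp π).point_eq ?_⟩
  convert hv using 2 with l
  cases l <;> simp [w, hs, h1, hr, hu, hq]

/-- Over the origin, $u=1$ forces $p=0$ and $p_4=-r^2$, leaving $q$ and $r$ free. -/
theorem exists_lift_u (hv : HasCoord h u v) :
    ∃ h' : specOver R' ⟶ fibreAt Sigma.ideal 0, specOverMap π ≫ h' = h := by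
  have hI := fun f hf => hv.evalAt_eq_zero (f := f) hf
  have h1 := hv.apply_self
  have hp1 : v p1 = 0 := by simpa [h1, vecM, vecN] using up1_eq hI
  have hp2 : v p2 = 0 := by simpa [h1, vecM, vecN] using up2_eq hI
  have hp3 : v p3 = 0 := by simpa [h1, vecM, vecN] using up3_eq hI
  have hp4 : v p4 = -v r ^ 2 := by
    have := up4_eq hI
    simp [h1] at this
    linear_combination this
  choose s hs using hπ
  let w : SigmaFibre → R' := fun
    | p1 => 0
    | p2 => 0
    | p3 => 0
    | p4 => -s (v r) ^ 2
    | q1 => s (v q1)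
    | q2 => s (v q2)
    | q3 => s (v q3)
    | r => s (v r)
    | u => 1
  obtain ⟨h', hh'⟩ := exists_hasCoord (I := Sigma.ideal) (a := 0) u w rfl
    (evalAt_zero_eq_zero w (by simp [w]) (by simp [w]) (by simp [w]) (by simp [w])
      (by simp [w]) (by simp [w]) (by simp [w]) (by simp [w]))
  refine ⟨h', (hh'.comp π).point_eq ?_⟩
  convert hv using 2 with l
  cases l <;> simp [w, hs, h1, hp1, hp2, hp3, hp4]

end Lift

theorem not_hasObstructedPointOfDegree :
    ¬ HasObstructedPointOfDegree 4 (fibreAt Sigma.ideal 0) := by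
  rintro ⟨K, _, _, _, hK, hg, R, _, _, _, R', _, _, _, π, σ, h, hπ, hσ, rfl, hn⟩
  obtain ⟨i, hi⟩ := exists_inChart (specOverMap σ ≫ h)
  obtain ⟨v, hv⟩ := hi.exists_hasCoord
  -- If $v_j\ne0$, the closed point of the thickening lies in the chart of $j$; the thickening then
  -- has coordinates there and would lift.
  have hnot {j : SigmaFibre} (hj : ∀ w, HasCoord h j w → ∃ h', specOverMap π ≫ h' = h) :
      v j = 0 := by
    by_contra hne
    obtain ⟨w, hw⟩ := ((inChart_specOverMap σ h j).1
      ((hv.inChart_iff j).2 (isUnit_iff_ne_zero.2 hne))).exists_hasCoord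
    exact hn (hj w hw)
  have h1 : v p1 = 0 := hnot fun _ => exists_lift_p1 hπ
  have h2 : v p2 = 0 := hnot fun _ => exists_lift_p2 hπ
  have h3 : v p3 = 0 := hnot fun _ => exists_lift_p3 hπ
  have hu : v u = 0 := hnot fun _ => exists_lift_u hπ
  have hI := fun f hf => hv.evalAt_eq_zero (f := f) hf
  have hr : v r = 0 := by simpa [hu] using up4_eq hI
  have hi := hv.apply_self
  have hmem (l : Fin 4) : ![v p4, v q1, v q2, v q3] l ∈
      IntermediateField.adjoin ℂ (Set.range ![v p4, v q1, v q2, v q3]) :=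
    IntermediateField.subset_adjoin ℂ _ ⟨l, rfl⟩
  have hind := algebraicIndependent_of_le_trdeg ![v p4, v q1, v q2, v q3]
    (adjoin_eq_top_of_mem _ (hv.adjoin_eq_top hg) (by
      intro j
      cases j
      case p1 => rw [h1]; exact zero_mem _
      case p2 => rw [h2]; exact zero_mem _
      case p3 => rw [h3]; exact zero_mem _
      case p4 => exact hmem 0
      case q1 => exact hmem 1
      case q2 => exact hmem 2
      case q3 => exact hmem 3
      case r => rw [hr]; exact zero_mem _
      case u => rw [hu]; exact zero_mem _)) hK
  -- Only four homogeneous coordinates survive and one of them equals 1, so they cannot be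
  -- independent: the locus is a $\mathbb P^3$.
  have hne (l : Fin 4) : ![v p4, v q1, v q2, v q3] l ≠ 1 := by
    intro hl
    have := eval_eq_zero_of_algebraicIndependent hind (f := X l - 1) (by simp [hl]) 0
    simp at this
  cases i
  case p1 => simp [h1] at hi
  case p2 => simp [h2] at hi
  case p3 => simp [h3] at hi
  case p4 => exact hne 0 hi
  case q1 => exact hne 1 hi
  case q2 => exact hne 2 hi
  case q3 => exact hne 3 hi
  case r => simp [hr] at hi
  case u => simp [hu] at hi

end Sigma

theorem isEmpty_fibre_iso (a : SigmaBase → ℂ) :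
    IsEmpty (fibreAt Sigma.ideal a ≅ fibreAt Upsilon.ideal 0) := by
  refine ⟨fun e => ?_⟩
  by_cases ha : a = 0
  · subst ha
    exact Sigma.not_hasObstructedPointOfDegree (Upsilon.hasObstructedPointOfDegree.of_iso e.symm)
  · exact Sigma.not_hasPointOfDegree ha (Upsilon.hasPointOfDegree.of_iso e.symm)

/-! ### Fibres under an isomorphism of families. -/

section Transport

theorem exists_fiber_iso {X Y X' Y' : Scheme} (f : X ⟶ Y) (f' : X' ⟶ Y') (i : X ⟶ X') (j : Y ⟶ Y')
    [IsIso i] [IsIso j] (h : f ≫ j = i ≫ f') (y : Y) :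
    ∃ e : f.fiber y ≅ f'.fiber (j y), e.hom ≫ f'.fiberι (j y) = f.fiberι y ≫ i := by
  have hw : Y.fromSpecResidueField y ≫ j =
      Spec.map (j.residueFieldMap y) ≫ Y'.fromSpecResidueField (j y) := by simp
  have : IsIso (Limits.pullback.map f (Y.fromSpecResidueField y) f'
      (Y'.fromSpecResidueField (j y)) i (Spec.map (j.residueFieldMap y)) j h hw) :=
    Limits.pullback.map_isIso _ _ _ _ _ _ _ _ _
  exact ⟨@asIso _ _ _ _ _ this, Limits.pullback.lift_fst _ _ _⟩

/-- Fibres of isomorphic families over corresponding points are isomorphic. -/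
theorem nonempty_fibre_iso {X Y X' Y' : Over (Spec (CommRingCat.of ℂ))} {f : X ⟶ Y} {f' : X' ⟶ Y'}
    (φ : X ≅ X') (ψ : Y ≅ Y') (h : φ.hom ≫ f' = f ≫ ψ.hom) {y : Y.left}
    {y' : Y'.left} (hy : ψ.hom.left y = y') : Nonempty (fibre f y ≅ fibre f' y') := by
  subst hy
  have hsq : f.left ≫ ψ.hom.left = φ.hom.left ≫ f'.left := by
    rw [← Over.comp_left, ← h, Over.comp_left]
  have : IsIso φ.hom.left := ((Over.forget _).mapIso φ).isIso_hom
  have : IsIso ψ.hom.left := ((Over.forget _).mapIso ψ).isIso_hom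
  obtain ⟨e, hm⟩ := exists_fiber_iso f.left f'.left φ.hom.left ψ.hom.left hsq y
  refine ⟨Over.isoMk e ?_⟩
  change e.hom ≫ f'.left.fiberι (ψ.hom.left y) ≫ X'.hom = f.left.fiberι y ≫ X.hom
  rw [← Category.assoc, hm, Category.assoc, Over.w]

/-- The inverse of $\psi$ is given by a $\mathbb C$-algebra map $e$ of polynomial rings, and
evaluation at $a'$ after $e$ is evaluation at the point with coordinates $e(X_b)(a')$. -/
theorem exists_affinePoint_eq {B B' : Type} (ψ : affineSpace B ≅ affineSpace B') (a' : B' → ℂ) :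
    ∃ a : B → ℂ, ψ.hom.left (affinePoint a) = affinePoint a' := by
  obtain ⟨e, he⟩ := Spec.map_surjective (R := CommRingCat.of (MvPolynomial B ℂ))
    (S := CommRingCat.of (MvPolynomial B' ℂ)) ψ.inv.left
  have hC (z : ℂ) : e.hom (MvPolynomial.C z) = MvPolynomial.C z := by
    have hw : Spec.map e ≫ (affineSpace B).hom = (affineSpace B').hom := by
      rw [he]
      exact Over.w ψ.inv
    have hw' : Spec.map e ≫ Spec.map (CommRingCat.ofHom (algebraMap ℂ (MvPolynomial B ℂ))) =
      Spec.map (CommRingCat.ofHom (algebraMap ℂ (MvPolynomial B' ℂ))) := hw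
    rw [← Spec.map_comp, Spec.map_inj] at hw'
    exact congrArg (fun g => g.hom z) hw'
  let a : B → ℂ := fun b => MvPolynomial.eval a' (e.hom (MvPolynomial.X b))
  have ha : (MvPolynomial.eval a').comp e.hom = MvPolynomial.eval a := by
    apply MvPolynomial.ringHom_ext
    · intro z
      rw [RingHom.comp_apply]
      erw [hC]
      simp
    · intro b
      simp [a]
  have hpt : ψ.inv.left (affinePoint a') = affinePoint a := by
    rw [← he]
    refine PrimeSpectrum.ext ?_
    change Ideal.comap e.hom (RingHom.ker (MvPolynomial.eval a')) = RingHom.ker (MvPolynomial.eval a)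
    rw [RingHom.comap_ker, ha]
  refine ⟨a, ?_⟩
  rw [← hpt, ← Scheme.Hom.comp_apply, ← Over.comp_left, ψ.inv_hom_id]
  rfl

end Transport

end QuadricFamily

theorem proposition7p3 :
    (¬ ∃ (φ : QuadricFamily.sigmaHat ≅ QuadricFamily.upsilonHat)
        (ψ : QuadricFamily.sigmaBase ≅ QuadricFamily.upsilonBase),
        φ.hom ≫ QuadricFamily.rhoUpsilon = QuadricFamily.rhoSigma ≫ ψ.hom) ∧
      ∀ a : QuadricFamily.SigmaBase → ℂ,
        IsEmpty (QuadricFamily.fibre QuadricFamily.rhoSigma (QuadricFamily.affinePoint a) ≅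
          QuadricFamily.fibre QuadricFamily.rhoUpsilon (QuadricFamily.affinePoint 0)) := by
  refine ⟨?_, QuadricFamily.isEmpty_fibre_iso⟩
  rintro ⟨φ, ψ, h⟩
  obtain ⟨a, ha⟩ := QuadricFamily.exists_affinePoint_eq ψ 0
  obtain ⟨e⟩ := QuadricFamily.nonempty_fibre_iso φ ψ h ha
  exact (QuadricFamily.isEmpty_fibre_iso a).false e
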